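/- **Theorem 3.8.** Let $\Bbbk$ be a field. All operads are symmetric operads over $\Bbbk$ with components $\mathcal P(n)$, $n\ge 0$, and an isomorphism of operads is a family of linear isomorphisms $\mathcal P(n)\to\mathcal Q(n)$ compatible with the identity $\mathbf 1\in\mathcal P(1)$, the $\mathbb S_n$-actions and the partial compositions $\circ_i$. Let $\mathcal{A}s$, $\mathcal{C}om$ and $\mathcal{P}ois$ be the operads of unital associative algebras, of unital commutative algebras and of unital commutative Poisson algebras: $\mathcal{A}s(n)=\Bbbk\mathbb S_n$, $\mathcal{C}om(n)=\Bbbk$, and $\mathcal{P}ois$ is generated by $\mathbf 1_0$ (arity $0$), $\mathbf 1_2$ and $\tau$ (arity $2$) subject to $$\mathbf 1_2\circ_1\mathbf 1_0=\mathbf 1_2\circ_2\mathbf 1_0=\mathbf 1,\quad \tau\circ_1\mathbf 1_0=\tau\circ_2\mathbf 1_0=0,\quad \mathbf 1_2*(12)=\mathbf 1_2,\quad \tau*(12)=-\tau,\quad \mathbf 1_2\circ_1\mathbf 1_2=\mathbf 1_2\circ_2\mathbf 1_2,$$ $$\tau\circ_1\mathbf 1_2=\mathbf 1_2\circ_2\tau+(\mathbf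 1_2\circ_2\tau)*(12),\qquad \tau\circ_2\tau=\tau\circ_1\tau+(\tau\circ_2\tau)*(12).$$ For an operad $\mathcal P$ with $\mathcal P(0)=\Bbbk\mathbf 1_0\cong\Bbbk$ and $I\subseteq\{1,\dots,n\}$, let $\pi^I:\mathcal P(n)\to\mathcal P(|I|)$ be the map that inserts $\mathbf 1_0$ in every slot not in $I$ (and the identity $\mathbf 1$ in the slots in $I$). For $k\ge 1$ the $k$-th truncation ideal ${}^k\mathcal I={}^k\mathcal I_{\mathcal P}$ of $\mathcal P$ is given by ${}^k\mathcal I(n)=\bigcap_{|I|=k-1}\ker\pi^I$ if $n\ge k$ and ${}^k\mathcal I(n)=0$ if $n<k$. In $\mathcal{A}s/{}^k\mathcal I$ and $\mathcal{P}ois/{}^k\mathcal I$, the ideal ${}^k\mathcal I$ is that of $\mathcal{A}s$, respectively of $\mathcal{P}ois$. A derivation of $\mathcal P$ is a family $\partial$ of $\mathbb S_n$-equivariant linear maps $\mathcal P(n)\to\mathcal P(n)$ with $\partial(\mu\circ_i\nu)=\partial(\mu)\circ_i\nu+\mu\circ_i\partial(\nu)$; it is inner if for some $\lambda\in\mathcal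 P(1)$ one has $\partial(\theta)=\lambda\circ_1\theta-\sum_{i=1}^n\theta\circ_i\lambda$ for all $n$ and all $\theta\in\mathcal P(n)$; and $H^1(\mathcal P)$ is the $\Bbbk$-space of derivations modulo inner derivations. 1. $\mathcal{A}s/{}^1\mathcal I\cong\mathcal{P}ois/{}^1\mathcal I\cong\mathcal{A}s/{}^2\mathcal I\cong\mathcal{P}ois/{}^2\mathcal I\cong\mathcal{C}om$, and $H^1(\mathcal P)=0$ for each of these operads $\mathcal P$. 2. If $\operatorname{char}\Bbbk\ne 2$, then $\mathcal{A}s/{}^3\mathcal I\cong\mathcal{P}ois/{}^3\mathcal I$, and $H^1(\mathcal P)\cong\Bbbk$ for each of these two operads $\mathcal P$. 3. If $\operatorname{char}\Bbbk=2$, then $\mathcal{A}s/{}^3\mathcal I\not\cong\mathcal{P}ois/{}^3\mathcal I$. 4. For every $k\ge 4$, $\mathcal{A}s/{}^k\mathcal I\not\cong\mathcal{P}ois/{}^k\mathcal I$. -/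

import Mathlib

universe u

namespace Operadic
/-- Where an index `a ≠ i` goes when slot `i` is replaced by a block of `n` slots. -/
def shift (i n a : ℕ) : ℕ := if a < i then a else a + n - 1

/-- The slot in `Fin r`, `r = m + n - 1`, of an index `a ≠ i` of `Fin m` after replacing slot `i`
of `Fin m` by a block of `n` slots. -/
def outerPos {m n r : ℕ} (h : m + n = r + 1) (i a : Fin m) (ha : a ≠ i) : Fin r :=
  ⟨shift i n a, by have := Fin.val_ne_of_ne ha; unfold shift; split_ifs <;> omega⟩

/-- The slot in `Fin r`, `r = m + n - 1`, of an index `b` of the block of `n` slots replacing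
slot `i` of `Fin m`. -/
def innerPos {m n r : ℕ} (h : m + n = r + 1) (i : Fin m) (b : Fin n) : Fin r :=
  ⟨i + b, by omega⟩

theorem outerPos_val {m n r : ℕ} (h : m + n = r + 1) (i a : Fin m) (ha : a ≠ i) :
    (outerPos h i a ha).1 = shift i.1 n a.1 := rfl

theorem innerPos_val {m n r : ℕ} (h : m + n = r + 1) (i : Fin m) (b : Fin n) :
    (innerPos h i b).1 = i.1 + b.1 := rfl

/-- The slots after replacing slot `i` of `Fin m` by a block of `n` slots. -/
noncomputable def blockEquiv {m n r : ℕ} (h : m + n = r + 1) (i : Fin m) :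
    {a : Fin m // a ≠ i} ⊕ Fin n ≃ Fin r :=
  Equiv.ofBijective (Sum.elim (fun a => outerPos h i a.1 a.2) (innerPos h i)) (by
    constructor
    · rintro (⟨a, ha⟩ | b) (⟨a', ha'⟩ | b') hab
      all_goals
        have hv := congrArg Fin.val hab
        simp only [Sum.elim_inl, Sum.elim_inr, outerPos_val, innerPos_val] at hv
      · have h1 := Fin.val_ne_of_ne ha
        have h2 := Fin.val_ne_of_ne ha'
        have : a = a' := by
          ext; unfold shift at hv; split_ifs at hv <;> omega
        subst this; rfl
      · have h1 := Fin.val_ne_of_ne ha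
        unfold shift at hv; split_ifs at hv <;> omega
      · have h1 := Fin.val_ne_of_ne ha'
        unfold shift at hv; split_ifs at hv <;> omega
      · have : b = b' := by ext; omega
        rw [this]
    · intro x
      by_cases h1 : x.1 < i.1
      · refine ⟨Sum.inl ⟨⟨x, by omega⟩, fun e => ?_⟩, ?_⟩
        · have := congrArg Fin.val e; simp at this; omega
        · ext; simp [outerPos_val, shift, h1]
      · by_cases h2 : x.1 < i.1 + n
        · refine ⟨Sum.inr ⟨x - i, by omega⟩, ?_⟩
          ext; simp [innerPos_val]; omega
        · refine ⟨Sum.inl ⟨⟨x + 1 - n, by omega⟩, fun e => ?_⟩, ?_⟩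
          · have := congrArg Fin.val e; simp at this; omega
          · ext; simp only [Sum.elim_inl, outerPos_val, shift]; split_ifs <;> omega)

/-- The partial composition `φ ∘ᵢ σ` of permutations. Here `φ a` is the position of the variable
`a` in the word encoded by `φ`, and in the word of `φ ∘ᵢ σ` the variable `i` of the word of `φ` is
replaced by the word of `σ` (and the variables are renumbered in order). -/
noncomputable def permComp {m n r : ℕ} (h : m + n = r + 1) (i : Fin m) (φ : Equiv.Perm (Fin m))
    (σ : Equiv.Perm (Fin n)) : Equiv.Perm (Fin r) :=
  ((blockEquiv h i).symm.trans
    (Equiv.sumCongr (φ.subtypeEquiv fun _ => φ.injective.ne_iff.symm) σ)).trans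
      (blockEquiv h (φ i))

theorem permComp_outer {m n r : ℕ} (h : m + n = r + 1) (i : Fin m) (φ : Equiv.Perm (Fin m))
    (σ : Equiv.Perm (Fin n)) (a : Fin m) (ha : a ≠ i) :
    permComp h i φ σ (outerPos h i a ha) = outerPos h (φ i) (φ a) (φ.injective.ne ha) := by
  have : (blockEquiv h i).symm (outerPos h i a ha) = Sum.inl ⟨a, ha⟩ := by
    rw [Equiv.symm_apply_eq]; rfl
  simp only [permComp, Equiv.trans_apply, this]; rfl

theorem permComp_inner {m n r : ℕ} (h : m + n = r + 1) (i : Fin m) (φ : Equiv.Perm (Fin m))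
    (σ : Equiv.Perm (Fin n)) (b : Fin n) :
    permComp h i φ σ (innerPos h i b) = innerPos h (φ i) (σ b) := by
  have : (blockEquiv h i).symm (innerPos h i b) = Sum.inr b := by
    rw [Equiv.symm_apply_eq]; rfl
  simp only [permComp, Equiv.trans_apply, this]; rfl

theorem pos_cases {m n r : ℕ} (h : m + n = r + 1) (i : Fin m) (x : Fin r) :
    (∃ a ha, x = outerPos h i a ha) ∨ ∃ b, x = innerPos h i b := by
  obtain ⟨y | b, rfl⟩ := (blockEquiv h i).surjective x
  · exact Or.inl ⟨y.1, y.2, rfl⟩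
  · exact Or.inr ⟨b, rfl⟩

theorem permComp_outer' {m n r : ℕ} (h : m + n = r + 1) {i : Fin m} (φ : Equiv.Perm (Fin m))
    (σ : Equiv.Perm (Fin n)) {x : Fin r} (a : Fin m) (ha : a ≠ i)
    (hx : x.1 = shift i.1 n a.1) :
    (permComp h i φ σ x).1 = shift (φ i).1 n (φ a).1 := by
  have : x = outerPos h i a ha := Fin.ext (by rw [hx, outerPos_val])
  rw [this, permComp_outer, outerPos_val]

theorem permComp_inner' {m n r : ℕ} (h : m + n = r + 1) {i : Fin m} (φ : Equiv.Perm (Fin m))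
    (σ : Equiv.Perm (Fin n)) {x : Fin r} (b : Fin n) (hx : x.1 = i.1 + b.1) :
    (permComp h i φ σ x).1 = (φ i).1 + (σ b).1 := by
  have : x = innerPos h i b := Fin.ext hx
  rw [this, permComp_inner, innerPos_val]

theorem permComp_mul {m n r : ℕ} (h : m + n = r + 1) (i : Fin m) (φ ψ : Equiv.Perm (Fin m))
    (σ τ : Equiv.Perm (Fin n)) :
    permComp h i (φ * ψ) (σ * τ) = permComp h (ψ i) φ σ * permComp h i ψ τ := by
  ext1 x
  rcases pos_cases h i x with ⟨a, ha, rfl⟩ | ⟨b, rfl⟩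
  · rw [Equiv.Perm.mul_apply, permComp_outer, permComp_outer, permComp_outer]; rfl
  · rw [Equiv.Perm.mul_apply, permComp_inner, permComp_inner, permComp_inner]; rfl

theorem permComp_one_right {m : ℕ} (i : Fin m) (φ : Equiv.Perm (Fin m)) :
    permComp (n := 1) rfl i φ 1 = φ := by
  ext x
  by_cases hx : x = i
  · subst hx
    rw [permComp_inner' _ _ _ 0 (by simp)]; simp
  · rw [permComp_outer' _ _ _ x hx (by simp [shift])]; simp [shift]

theorem permComp_one_left {n : ℕ} (h : 1 + n = n + 1) (σ : Equiv.Perm (Fin n)) :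
    permComp h 0 1 σ = σ := by
  ext x
  rw [permComp_inner' _ _ _ x (by simp)]; simp

theorem permComp_assoc {l m n p q r : ℕ} (hp : l + m = p + 1) (hr : p + n = r + 1)
    (hq : m + n = q + 1) (hr' : l + q = r + 1) (i : Fin l) (j : Fin m)
    (φ : Equiv.Perm (Fin l)) (σ : Equiv.Perm (Fin m)) (τ : Equiv.Perm (Fin n)) :
    permComp hr ⟨i + j, by omega⟩ (permComp hp i φ σ) τ =
      permComp hr' i φ (permComp hq j σ τ) := by
  have hij : (permComp hp i φ σ ⟨i + j, by omega⟩).1 = φ i + σ j :=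
    permComp_inner' _ _ _ j rfl
  ext x
  rcases pos_cases hr ⟨i + j, by omega⟩ x with ⟨y, hy, rfl⟩ | ⟨c, rfl⟩
  · have hy' := Fin.val_ne_of_ne hy
    rw [permComp_outer' hr _ _ y hy (outerPos_val ..), hij]
    rcases pos_cases hp i y with ⟨a, ha, rfl⟩ | ⟨b, rfl⟩
    · have ha' := Fin.val_ne_of_ne ha
      have hφ := Fin.val_ne_of_ne (φ.injective.ne ha)
      rw [permComp_outer, outerPos_val]
      rw [permComp_outer' hr' φ _ a ha]
      · unfold shift; split_ifs <;> omega
      · simp only [outerPos_val]; unfold shift; split_ifs <;> omega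
    · have hb : b ≠ j := by rintro rfl; exact hy rfl
      rw [permComp_inner, innerPos_val]
      have := Fin.val_ne_of_ne hb
      have hσ := Fin.val_ne_of_ne (σ.injective.ne hb)
      rw [permComp_inner' hr' φ _ (outerPos hq j b hb), permComp_outer, outerPos_val]
      · unfold shift; split_ifs <;> omega
      · simp only [outerPos_val, innerPos_val]; unfold shift; split_ifs <;> omega
  · rw [permComp_inner, innerPos_val, hij,
      permComp_inner' hr' φ _ (innerPos hq j c), permComp_inner, innerPos_val]
    · omega
    · simp only [innerPos_val]; omega

theorem permComp_comm {l m n p q r : ℕ} (hp : l + m = p + 1) (hr : p + n = r + 1)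
    (hq : l + n = q + 1) (hr' : q + m = r + 1) (i j : Fin l) (hij : i < j)
    (φ : Equiv.Perm (Fin l)) (σ : Equiv.Perm (Fin m)) (τ : Equiv.Perm (Fin n)) :
    permComp hr ⟨j + m - 1, by omega⟩ (permComp hp i φ σ) τ =
      permComp hr' ⟨i, by omega⟩ (permComp hq j φ τ) σ := by
  have hij' : i.1 < j.1 := hij
  have hji : j ≠ i := ne_of_gt hij
  have hne := Fin.val_ne_of_ne (φ.injective.ne hji)
  have e1 := permComp_outer' hp φ σ (x := ⟨j + m - 1, by omega⟩) j hji
    (by dsimp only; unfold shift; split_ifs <;> omega)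
  have e2 := permComp_outer' hq φ τ (x := ⟨i, by omega⟩) i hji.symm
    (by simp only [shift, if_pos hij'])
  ext x
  rcases pos_cases hr ⟨j + m - 1, by omega⟩ x with ⟨y, hy, rfl⟩ | ⟨c, rfl⟩
  · have hy' := Fin.val_ne_of_ne hy
    rw [permComp_outer' hr _ _ y hy (outerPos_val ..), e1]
    rcases pos_cases hp i y with ⟨a, ha, rfl⟩ | ⟨b, rfl⟩
    · have ha' := Fin.val_ne_of_ne ha
      have haj : a ≠ j := by
        rintro rfl; apply hy; ext; simp only [outerPos_val]; unfold shift; split_ifs <;> omega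
      have haj' := Fin.val_ne_of_ne haj
      have hφ := Fin.val_ne_of_ne (φ.injective.ne ha)
      have hφ' := Fin.val_ne_of_ne (φ.injective.ne haj)
      rw [permComp_outer, outerPos_val]
      rw [permComp_outer' hr' _ σ (outerPos hq j a haj), permComp_outer, outerPos_val, e2]
      · unfold shift; split_ifs <;> omega
      · intro e; have := congrArg Fin.val e
        simp only [outerPos_val] at this; unfold shift at this; split_ifs at this <;> omega
      · simp only [outerPos_val]; unfold shift; split_ifs <;> omega
    · rw [permComp_inner, innerPos_val, permComp_inner' hr' _ σ b, e2]
      · unfold shift; split_ifs <;> omega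
      · simp only [outerPos_val, innerPos_val]; unfold shift; split_ifs <;> omega
  · rw [permComp_inner, innerPos_val, e1]
    rw [permComp_outer' hr' _ σ (innerPos hq j c), permComp_inner, innerPos_val, e2]
    · unfold shift; split_ifs <;> omega
    · intro e; have := congrArg Fin.val e
      simp only [innerPos_val] at this; omega
    · simp only [innerPos_val]; unfold shift; split_ifs <;> omega

/-! ### Operads, by partial compositions

Slots are numbered from `0`. The arity `m + n - 1` of a partial composition is carried as a variable
`r` with a proof of `m + n = r + 1`, so that no transport between types is needed. -/

/-- A symmetric operad over `𝕜` (partial definition). -/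
structure Operad (𝕜 : Type u) [CommRing 𝕜] where
  /-- the module of operations of arity `n` -/
  obj : ℕ → Type u
  [grp : ∀ n, AddCommGroup (obj n)]
  [mod : ∀ n, Module 𝕜 (obj n)]
  /-- the right action of the symmetric group: `act σ θ` is `θ * σ` -/
  act : ∀ {n : ℕ}, Equiv.Perm (Fin n) → obj n →ₗ[𝕜] obj n
  /-- the identity operation -/
  one : obj 1
  /-- the partial composition: `comp h i μ ν` is `μ ∘ᵢ ν` -/
  comp : ∀ {m n r : ℕ}, m + n = r + 1 → Fin m → obj m →ₗ[𝕜] obj n →ₗ[𝕜] obj r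
  act_one : ∀ {n : ℕ} (θ : obj n), act 1 θ = θ
  act_mul : ∀ {n : ℕ} (σ τ : Equiv.Perm (Fin n)) (θ : obj n), act (σ * τ) θ = act τ (act σ θ)
  comp_one : ∀ {n : ℕ} (i : Fin n) (θ : obj n), comp rfl i θ one = θ
  one_comp : ∀ {n : ℕ} (h : 1 + n = n + 1) (θ : obj n), comp h 0 one θ = θ
  comp_assoc : ∀ {l m n p q r : ℕ} (hp : l + m = p + 1) (hr : p + n = r + 1)
    (hq : m + n = q + 1) (hr' : l + q = r + 1) (i : Fin l) (j : Fin m)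
    (a : obj l) (b : obj m) (c : obj n),
    comp hr ⟨i + j, by omega⟩ (comp hp i a b) c = comp hr' i a (comp hq j b c)
  comp_comm : ∀ {l m n p q r : ℕ} (hp : l + m = p + 1) (hr : p + n = r + 1)
    (hq : l + n = q + 1) (hr' : q + m = r + 1) (i j : Fin l) (_ : i < j)
    (a : obj l) (b : obj m) (c : obj n),
    comp hr ⟨j + m - 1, by omega⟩ (comp hp i a b) c = comp hr' ⟨i, by omega⟩ (comp hq j a c) b
  comp_act : ∀ {m n r : ℕ} (h : m + n = r + 1) (i : Fin m) (μ : obj m) (ν : obj n)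
    (σ : Equiv.Perm (Fin n)), comp h i μ (act σ ν) = act (permComp h i 1 σ) (comp h i μ ν)
  act_comp : ∀ {m n r : ℕ} (h : m + n = r + 1) (i : Fin m) (μ : obj m) (ν : obj n)
    (φ : Equiv.Perm (Fin m)), comp h i (act φ μ) ν = act (permComp h i φ 1) (comp h (φ i) μ ν)

attribute [instance] Operad.grp Operad.mod

/-- A unitary operad: `P(0)` is free of rank one on the chosen element `unit0`. -/
structure UnitaryOperad (𝕜 : Type u) [CommRing 𝕜] extends Operad 𝕜 where
  unit0 : obj 0
  unit0_basis : Function.Bijective fun c : 𝕜 => c • unit0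

/-- Morphisms of operads. -/
structure OperadHom {𝕜 : Type u} [CommRing 𝕜] (P Q : Operad 𝕜) where
  toFun : ∀ n, P.obj n →ₗ[𝕜] Q.obj n
  map_one : toFun 1 P.one = Q.one
  map_act : ∀ {n : ℕ} (σ : Equiv.Perm (Fin n)) (θ : P.obj n),
    toFun n (P.act σ θ) = Q.act σ (toFun n θ)
  map_comp : ∀ {m n r : ℕ} (h : m + n = r + 1) (i : Fin m) (μ : P.obj m) (ν : P.obj n),
    toFun r (P.comp h i μ ν) = Q.comp h i (toFun m μ) (toFun n ν)

/-- Two operads are isomorphic if there is a morphism between them that is bijective in every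
arity. -/
def OperadIso {𝕜 : Type u} [CommRing 𝕜] (P Q : Operad 𝕜) : Prop :=
  ∃ f : OperadHom P Q, ∀ n, Function.Bijective (f.toFun n)

namespace Operad

variable {𝕜 : Type u} [CommRing 𝕜]

/-! ### Derivations and the first cohomology group -/

/-- The module of derivations of an operad, inside the families of linear maps. -/
def der (P : Operad 𝕜) : Submodule 𝕜 (∀ n, P.obj n →ₗ[𝕜] P.obj n) where
  carrier := {d | (∀ (n : ℕ) (σ : Equiv.Perm (Fin n)) (θ : P.obj n),
      d n (P.act σ θ) = P.act σ (d n θ)) ∧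
    ∀ (m n r : ℕ) (h : m + n = r + 1) (i : Fin m) (μ : P.obj m) (ν : P.obj n),
      d r (P.comp h i μ ν) = P.comp h i (d m μ) ν + P.comp h i μ (d n ν)}
  zero_mem' := by constructor <;> intros <;> simp
  add_mem' := by
    rintro d e ⟨hd, hd'⟩ ⟨he, he'⟩
    refine ⟨fun n σ θ => ?_, fun m n r h i μ ν => ?_⟩
    · simp [hd, he]
    · simp only [Pi.add_apply, LinearMap.add_apply, hd', he', map_add]; abel
  smul_mem' := by
    rintro c d ⟨hd, hd'⟩
    refine ⟨fun n σ θ => ?_, fun m n r h i μ ν => ?_⟩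
    · simp [hd]
    · simp [hd']

/-- The inner derivations: those of the form `θ ↦ a ∘₁ θ - ∑ᵢ θ ∘ᵢ a` with `a` in `P(1)`. -/
def innerDer (P : Operad 𝕜) : Submodule 𝕜 P.der where
  carrier := {d | ∃ a : P.obj 1, ∀ (n : ℕ) (θ : P.obj n),
    d.1 n θ = P.comp (Nat.add_comm 1 n) 0 a θ - ∑ i : Fin n, P.comp rfl i θ a}
  zero_mem' := ⟨0, fun n θ => by simp⟩
  add_mem' := by
    rintro d e ⟨a, ha⟩ ⟨b, hb⟩
    refine ⟨a + b, fun n θ => ?_⟩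
    simp only [Submodule.coe_add, Pi.add_apply, LinearMap.add_apply, ha, hb, map_add,
      Finset.sum_add_distrib]
    abel
  smul_mem' := by
    rintro c d ⟨a, ha⟩
    refine ⟨c • a, fun n θ => ?_⟩
    simp [ha, Finset.smul_sum, smul_sub]

/-- The first cohomology group `H¹(P)`: derivations modulo inner derivations. -/
abbrev H1 (P : Operad 𝕜) : Type u := P.der ⧸ P.innerDer

/-! ### Ideals and quotients -/

/-- An operadic ideal. -/
structure OpIdeal (P : Operad 𝕜) where
  carrier : ∀ n, Submodule 𝕜 (P.obj n)
  act_mem : ∀ {n : ℕ} (σ : Equiv.Perm (Fin n)) (θ : P.obj n),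
    θ ∈ carrier n → P.act σ θ ∈ carrier n
  comp_mem_left : ∀ {m n r : ℕ} (h : m + n = r + 1) (i : Fin m) (μ : P.obj m) (ν : P.obj n),
    μ ∈ carrier m → P.comp h i μ ν ∈ carrier r
  comp_mem_right : ∀ {m n r : ℕ} (h : m + n = r + 1) (i : Fin m) (μ : P.obj m) (ν : P.obj n),
    ν ∈ carrier n → P.comp h i μ ν ∈ carrier r

/-- The quotient operad `P/I`. -/
def quotient (P : Operad 𝕜) (I : P.OpIdeal) : Operad 𝕜 where
  obj n := P.obj n ⧸ I.carrier n
  act {n} σ := (I.carrier n).mapQ (I.carrier n) (P.act σ) fun θ hθ => I.act_mem σ θ hθ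
  one := Submodule.Quotient.mk P.one
  comp {m n r} h i := (I.carrier m).liftQ
    { toFun := fun μ => (I.carrier n).mapQ (I.carrier r) (P.comp h i μ)
        fun ν hν => I.comp_mem_right h i μ ν hν
      map_add' := fun μ μ' => by ext ν; simp
      map_smul' := fun c μ => by ext ν; simp }
    (fun μ hμ => by
      rw [LinearMap.mem_ker]
      ext ν
      simpa using I.comp_mem_left h i μ ν hμ)
  act_one {n} θ := by
    induction θ using Submodule.Quotient.induction_on with | _ θ
    simp [P.act_one]
  act_mul {n} σ τ θ := by
    induction θ using Submodule.Quotient.induction_on with | _ θ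
    simp [P.act_mul]
  comp_one {n} i θ := by
    induction θ using Submodule.Quotient.induction_on with | _ θ
    simp [P.comp_one]
  one_comp {n} h θ := by
    induction θ using Submodule.Quotient.induction_on with | _ θ
    simp [P.one_comp]
  comp_assoc {l m n p q r} hp hr hq hr' i j a b c := by
    induction a using Submodule.Quotient.induction_on with | _ a
    induction b using Submodule.Quotient.induction_on with | _ b
    induction c using Submodule.Quotient.induction_on with | _ c
    simp [P.comp_assoc hp hr hq hr']
  comp_comm {l m n p q r} hp hr hq hr' i j hij a b c := by
    induction a using Submodule.Quotient.induction_on with | _ a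
    induction b using Submodule.Quotient.induction_on with | _ b
    induction c using Submodule.Quotient.induction_on with | _ c
    simp [P.comp_comm hp hr hq hr' i j hij]
  comp_act {m n r} h i μ ν σ := by
    induction μ using Submodule.Quotient.induction_on with | _ μ
    induction ν using Submodule.Quotient.induction_on with | _ ν
    simp [P.comp_act]
  act_comp {m n r} h i μ ν φ := by
    induction μ using Submodule.Quotient.induction_on with | _ μ
    induction ν using Submodule.Quotient.induction_on with | _ ν
    simp [P.act_comp]

/-! ### Total compositions -/

/-- Composition of `θ ∈ P(n + s)` with `ν 0, …, ν (n - 1)` in the first `n` slots (and with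
identities in the last `s` slots), filling the slots from the last to the first. For `s = 0` this is
the total composition `θ ∘ (ν 0, …, ν (n - 1))`. In the base case the composition with the identity
only adjusts the expression for the arity. -/
def totalComp (P : Operad 𝕜) : ∀ (n s : ℕ) {r : ℕ} (a : Fin n → ℕ) (_ : ∀ i, P.obj (a i))
    (_ : (∑ i, a i) + s = r), P.obj (n + s) →ₗ[𝕜] P.obj r
  | 0, s, r, a, _, h => P.comp (m := 1) (n := 0 + s) (r := r) (by simp at h; omega) 0 P.one
  | n + 1, s, r, a, ν, h =>
    (P.totalComp n (a (Fin.last n) + s) (fun i => a i.castSucc) (fun i => ν i.castSucc)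
      (by rw [Fin.sum_univ_castSucc] at h; omega)) ∘ₗ
    (P.comp (m := n + 1 + s) (n := a (Fin.last n)) (r := n + (a (Fin.last n) + s)) (by omega)
      ⟨n, by omega⟩).flip (ν (Fin.last n))

end Operad

namespace UnitaryOperad

variable {𝕜 : Type u} [CommRing 𝕜]

/-! ### Truncation ideals of unitary operads -/

/-- `1_χ`: the identity for `true`, the `0`-unit for `false`. -/
def unitOf (P : UnitaryOperad 𝕜) : ∀ b : Bool, P.obj b.toNat
  | true => P.one
  | false => P.unit0

theorem sum_toNat {n : ℕ} (I : Finset (Fin n)) :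
    (∑ i, (decide (i ∈ I)).toNat) + 0 = I.card := by
  simp [Bool.toNat, Bool.cond_decide]

/-- The restriction operator `π^I : P(n) → P(|I|)`, `θ ↦ θ ∘ (1_{χ_I(1)}, …, 1_{χ_I(n)})`. -/
def restrict (P : UnitaryOperad 𝕜) {n : ℕ} (I : Finset (Fin n)) :
    P.obj n →ₗ[𝕜] P.obj I.card :=
  P.totalComp n 0 (fun i => (decide (i ∈ I)).toNat) (fun i => P.unitOf (decide (i ∈ I)))
    (sum_toNat I)

/-- The modules of the `k`-th truncation ideal: `0` in arities `n < k`, and for `n ≥ k` the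
intersection of the kernels of all `π^I` with `|I| = k - 1`. For `k = 0` this is everything. -/
def truncSubmodule (P : UnitaryOperad 𝕜) (k n : ℕ) : Submodule 𝕜 (P.obj n) :=
  if n < k then ⊥
  else ⨅ (I : Finset (Fin n)) (_ : I.card + 1 = k), LinearMap.ker (P.restrict I)

/-- A recursive description of the same modules, used to show that they form an ideal. -/
def truncRec (P : UnitaryOperad 𝕜) (k : ℕ) : ∀ n, Submodule 𝕜 (P.obj n)
  | 0 => if 0 < k then ⊥ else ⊤
  | n + 1 => if n + 1 < k then ⊥ else
      ⨅ i : Fin (n + 1), (truncRec P k n).comap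
        ((P.comp (m := n + 1) (n := 0) (r := n) rfl i).flip P.unit0)

theorem truncRec_lt (P : UnitaryOperad 𝕜) {k n : ℕ} (h : n < k) : P.truncRec k n = ⊥ := by
  cases n <;> simp [truncRec, h]

theorem mem_truncRec (P : UnitaryOperad 𝕜) {k n m : ℕ} (h : m + 0 = n + 1) (hk : k ≤ m)
    (θ : P.obj m) :
    θ ∈ P.truncRec k m ↔ ∀ i, P.comp h i θ P.unit0 ∈ P.truncRec k n := by
  obtain rfl : m = n + 1 := h
  simp [truncRec, not_lt.mpr hk]

theorem truncRec_zero (P : UnitaryOperad 𝕜) (n : ℕ) : P.truncRec 0 n = ⊤ := by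
  induction n with
  | zero => simp [truncRec]
  | succ n ih => simp [truncRec, ih]

theorem truncRec_act (P : UnitaryOperad 𝕜) (k : ℕ) {n : ℕ} (σ : Equiv.Perm (Fin n))
    (θ : P.obj n) (hθ : θ ∈ P.truncRec k n) : P.act σ θ ∈ P.truncRec k n := by
  induction n with
  | zero => rwa [Subsingleton.elim σ 1, P.act_one]
  | succ n ih =>
    by_cases hk : n + 1 < k
    · rw [truncRec_lt P hk, Submodule.mem_bot] at *
      rw [hθ, map_zero]
    · rw [mem_truncRec P rfl (not_lt.mp hk)] at *
      intro i
      rw [P.act_comp]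
      exact ih _ _ (hθ _)

theorem truncRec_comp_right (P : UnitaryOperad 𝕜) (k : ℕ) : ∀ {r m n : ℕ} (h : m + n = r + 1)
    (i : Fin m) (μ : P.obj m) (ν : P.obj n), ν ∈ P.truncRec k n →
    P.comp h i μ ν ∈ P.truncRec k r := by
  intro r
  induction r with
  | zero =>
    intro m n h i μ ν hν
    by_cases hk : n < k
    · rw [truncRec_lt P hk, Submodule.mem_bot] at hν
      simp [hν]
    · by_cases h0 : k = 0
      · subst h0; simp [truncRec_zero]
      · have := i.2
        omega
  | succ r ih =>
    intro m n h i μ ν hν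
    by_cases hk : n < k
    · rw [truncRec_lt P hk, Submodule.mem_bot] at hν
      simp [hν]
    · by_cases h0 : k = 0
      · subst h0; simp [truncRec_zero]
      · have hi := i.2
        rw [mem_truncRec P (n := r) rfl (by omega)]
        intro x
        rcases pos_cases h i x with ⟨a, ha, rfl⟩ | ⟨b, rfl⟩
        · have ha' := Fin.val_ne_of_ne ha
          rcases lt_or_gt_of_ne ha with hlt | hlt
          · have hlt' : a.1 < i.1 := hlt
            have := P.comp_comm (l := m) (m := 0) (n := n) (p := m - 1) (q := r + 1) (r := r)
              (by omega) (by omega) h rfl a i hlt μ P.unit0 ν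
            have e : outerPos h i a ha = ⟨a, by omega⟩ := by
              ext; simp [outerPos_val, shift, hlt']
            rw [e, ← this]
            exact ih _ _ _ _ hν
          · have hlt' : i.1 < a.1 := hlt
            have := P.comp_comm (l := m) (m := n) (n := 0) (p := r + 1) (q := m - 1) (r := r)
              h rfl (by omega) (by omega) i a hlt μ ν P.unit0
            have e : outerPos h i a ha = ⟨a + n - 1, by omega⟩ := by
              ext; simp [outerPos_val, shift, not_lt.mpr hlt'.le]
            rw [e, this]
            exact ih _ _ _ _ hν
        · have := P.comp_assoc (l := m) (m := n) (n := 0) (p := r + 1) (q := n - 1) (r := r)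
            h rfl (by omega) (by omega) i b μ ν P.unit0
          have e : innerPos h i b = ⟨i + b, by omega⟩ := rfl
          rw [e, this]
          exact ih _ _ _ _ ((mem_truncRec P _ (not_lt.mp hk) _).mp hν b)

theorem exists_smul_unit0 (P : UnitaryOperad 𝕜) (ν : P.obj 0) : ∃ c : 𝕜, ν = c • P.unit0 :=
  let ⟨c, hc⟩ := P.unit0_basis.2 ν
  ⟨c, hc.symm⟩

theorem truncRec_comp_left (P : UnitaryOperad 𝕜) (k : ℕ) : ∀ {r m n : ℕ} (h : m + n = r + 1)
    (i : Fin m) (μ : P.obj m) (ν : P.obj n), μ ∈ P.truncRec k m →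
    P.comp h i μ ν ∈ P.truncRec k r := by
  intro r
  induction r with
  | zero =>
    intro m n h i μ ν hμ
    by_cases hk : m < k
    · rw [truncRec_lt P hk, Submodule.mem_bot] at hμ
      simp [hμ]
    · obtain rfl : n = 0 := by have := i.2; omega
      obtain ⟨c, rfl⟩ := P.exists_smul_unit0 ν
      rw [map_smul]
      exact Submodule.smul_mem _ _ ((mem_truncRec P h (not_lt.mp hk) _).mp hμ i)
  | succ r ih =>
    intro m n h i μ ν hμ
    by_cases hk : m < k
    · rw [truncRec_lt P hk, Submodule.mem_bot] at hμ
      simp [hμ]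
    · rcases Nat.eq_zero_or_pos n with rfl | hn
      · obtain ⟨c, rfl⟩ := P.exists_smul_unit0 ν
        rw [map_smul]
        exact Submodule.smul_mem _ _ ((mem_truncRec P h (not_lt.mp hk) _).mp hμ i)
      · have hi := i.2
        rw [mem_truncRec P (n := r) rfl (by omega)]
        intro x
        rcases pos_cases h i x with ⟨a, ha, rfl⟩ | ⟨b, rfl⟩
        · have ha' := Fin.val_ne_of_ne ha
          rcases lt_or_gt_of_ne ha with hlt | hlt
          · have hlt' : a.1 < i.1 := hlt
            have := P.comp_comm (l := m) (m := 0) (n := n) (p := m - 1) (q := r + 1) (r := r)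
              (by omega) (by omega) h rfl a i hlt μ P.unit0 ν
            have e : outerPos h i a ha = ⟨a, by omega⟩ := by
              ext; simp [outerPos_val, shift, hlt']
            rw [e, ← this]
            exact ih _ _ _ _ ((mem_truncRec P _ (not_lt.mp hk) _).mp hμ _)
          · have hlt' : i.1 < a.1 := hlt
            have := P.comp_comm (l := m) (m := n) (n := 0) (p := r + 1) (q := m - 1) (r := r)
              h rfl (by omega) (by omega) i a hlt μ ν P.unit0
            have e : outerPos h i a ha = ⟨a + n - 1, by omega⟩ := by
              ext; simp [outerPos_val, shift, not_lt.mpr hlt'.le]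
            rw [e, this]
            exact ih _ _ _ _ ((mem_truncRec P _ (not_lt.mp hk) _).mp hμ _)
        · have := P.comp_assoc (l := m) (m := n) (n := 0) (p := r + 1) (q := n - 1) (r := r)
            h rfl (by omega) (by omega) i b μ ν P.unit0
          have e : innerPos h i b = ⟨i + b, by omega⟩ := rfl
          rw [e, this]
          exact ih _ _ _ _ hμ

/-- Composition with `1_χ` in the first `n` slots, for `χ` given as a `Bool`-valued function. -/
def fill (P : UnitaryOperad 𝕜) (n s : ℕ) {r : ℕ} (c : Fin n → Bool)
    (h : (∑ i, (c i).toNat) + s = r) : P.obj (n + s) →ₗ[𝕜] P.obj r :=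
  P.totalComp n s (fun i => (c i).toNat) (fun i => P.unitOf (c i)) h

theorem fill_succ (P : UnitaryOperad 𝕜) (n s t : ℕ) {r : ℕ} (c : Fin (n + 1) → Bool)
    (h : (∑ i, (c i).toNat) + s = r) (θ : P.obj (n + 1 + s)) (b : Bool)
    (hb : c (Fin.last n) = b) (ht : b.toNat + s = t) :
    P.fill (n + 1) s c h θ = P.fill n t (fun i => c i.castSucc)
      (by rw [Fin.sum_univ_castSucc, hb] at h; omega)
      (P.comp (r := n + t) (by omega) ⟨n, by omega⟩ θ (P.unitOf b)) := by
  subst hb ht; rfl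

theorem fill_mem (P : UnitaryOperad 𝕜) (k n s : ℕ) {r : ℕ} (c : Fin n → Bool)
    (h : (∑ i, (c i).toNat) + s = r) (θ : P.obj (n + s)) (hθ : θ ∈ P.truncRec k (n + s)) :
    P.fill n s c h θ ∈ P.truncRec k r := by
  induction n generalizing s with
  | zero => exact P.truncRec_comp_right k _ _ _ _ hθ
  | succ n ih =>
    rw [fill_succ P n s _ c h θ _ rfl rfl]
    exact ih _ _ _ _ (P.truncRec_comp_left k _ _ _ _ hθ)

theorem fill_insert (P : UnitaryOperad 𝕜) (n s : ℕ) {r : ℕ} (c' : Fin (n + 1) → Bool)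
    (c : Fin n → Bool) (i : Fin (n + 1)) (hi : c' i = false)
    (hc : ∀ j, c' (i.succAbove j) = c j) (h' : (∑ i, (c' i).toNat) + s = r)
    (h : (∑ i, (c i).toNat) + s = r) (θ : P.obj (n + 1 + s)) :
    P.fill (n + 1) s c' h' θ =
      P.fill n s c h (P.comp (r := n + s) (by omega) ⟨i, by omega⟩ θ P.unit0) := by
  rcases Fin.eq_castSucc_or_eq_last i with ⟨i, rfl⟩ | rfl
  · induction n generalizing s with
    | zero => exact i.elim0
    | succ n ih =>
      have hl : c' (Fin.last (n + 1)) = c (Fin.last n) := by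
        rw [← hc]; congr 1; simp
      rw [fill_succ P (n + 1) s _ c' h' θ _ hl rfl, fill_succ P n s _ c h _ _ rfl rfl]
      have hc2 : ∀ j : Fin n, c' (i.succAbove j).castSucc = c j.castSucc := fun j => by
        rw [← hc]; congr 1; simp
      have step : ∀ (t : ℕ) (g) (g') (x : P.obj (n + 1 + t)),
          P.fill (r := r) (n + 1) t (fun i => c' i.castSucc) g x = P.fill (r := r) n t (fun i => c i.castSucc) g'
            (P.comp (r := n + t) (by omega) ⟨i, by omega⟩ x P.unit0) := by
        intro t g g' x
        rcases Fin.eq_castSucc_or_eq_last i with ⟨i, rfl⟩ | rfl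
        · exact ih t (fun i => c' i.castSucc) (fun i => c i.castSucc) g g' x i hi hc2
        · rw [fill_succ P n t t _ g x _ hi (by simp)]
          have e : (fun j : Fin n => c' j.castSucc.castSucc) = fun j => c j.castSucc := by
            funext j; rw [← hc2]; congr 2; simp
          simp only [e]
          rfl
      rw [step _ _ (by rw [Fin.sum_univ_castSucc] at h; omega)]
      congr 1
      exact P.comp_comm (l := n + 1 + 1 + s) (m := 0) _ _ _ _ ⟨i, by omega⟩
        ⟨n + 1, by omega⟩ (by rw [Fin.lt_def]; exact i.2) θ P.unit0 _ |>.symm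
  · rw [fill_succ P _ s s c' h' θ _ hi (by simp)]
    obtain rfl : (fun j => c' j.castSucc) = c := by
      funext j; rw [← hc]; congr 1; simp
    rfl

theorem fill_injective (P : UnitaryOperad 𝕜) (n s : ℕ) {r : ℕ} (c : Fin n → Bool)
    (h : (∑ i, (c i).toNat) + s = r) (hc : ∀ i, c i = true) (θ : P.obj (n + s))
    (hθ : P.fill n s c h θ = 0) : θ = 0 := by
  have key : ∀ {a b : ℕ} (e : a + 1 = b + 1) (i : Fin a) (x : P.obj a),
      P.comp e i x P.one = 0 → x = 0 := by
    intro a b e i x hx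
    obtain rfl : a = b := by omega
    rwa [P.comp_one] at hx
  induction n generalizing s with
  | zero =>
    obtain rfl : r = 0 + s := by simp at h; omega
    have := P.one_comp (by omega) θ
    rw [← this]; exact hθ
  | succ n ih =>
    rw [fill_succ P n s _ c h θ _ (hc _) rfl] at hθ
    exact key _ _ _ (ih _ _ _ (fun i => hc _) _ hθ)

theorem truncSubmodule_eq (P : UnitaryOperad 𝕜) (k n : ℕ) :
    P.truncSubmodule k n = P.truncRec k n := by
  by_cases hn : n < k
  · rw [truncRec_lt P hn, truncSubmodule, if_pos hn]
  rcases Nat.eq_zero_or_pos k with rfl | hk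
  · simp [truncSubmodule, truncRec_zero]
  ext θ
  have hmem : θ ∈ P.truncSubmodule k n ↔
      ∀ (r : ℕ) (c : Fin n → Bool) (h : (∑ i, (c i).toNat) + 0 = r), r + 1 = k →
        P.fill n 0 c h θ = 0 := by
    simp only [truncSubmodule, if_neg hn, Submodule.mem_iInf, LinearMap.mem_ker]
    constructor
    · intro H r c h hr
      have hc : c = fun i => decide (i ∈ Finset.univ.filter fun i => c i = true) := by
        funext i; simp
      generalize (Finset.univ.filter fun i => c i = true) = I at hc
      subst hc
      obtain rfl : I.card = r := (sum_toNat I).symm.trans h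
      exact H I hr
    · intro H I hI
      exact H _ _ _ hI
  rw [hmem]
  constructor
  · have main : ∀ (n : ℕ) (θ : P.obj n), k ≤ n + 1 → (∀ (r : ℕ) (c : Fin n → Bool)
        (h : (∑ i, (c i).toNat) + 0 = r), r + 1 = k → P.fill n 0 c h θ = 0) →
        θ ∈ P.truncRec k n := by
      intro n
      induction n with
      | zero =>
        intro θ hk' H
        have := fill_injective P 0 0 (fun _ => true) rfl (fun _ => rfl) θ
          (H _ _ _ (by simp; omega))
        rw [this]; exact zero_mem _
      | succ n ih =>
        intro θ hk' H
        by_cases hkn : k = n + 2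
        · have := fill_injective P (n + 1) 0 (fun _ => true) rfl (fun _ => rfl) θ
            (H _ _ _ (by simp; omega))
          rw [this]; exact zero_mem _
        · rw [mem_truncRec P (n := n) rfl (by omega)]
          intro i
          refine ih _ (by omega) fun r c h hr => ?_
          have hs : (∑ j, (i.insertNth (α := fun _ => Bool) false c j).toNat) + 0 = r := by
            rw [Fin.sum_univ_succAbove _ i]; simpa using h
          have := fill_insert P n 0 (i.insertNth (α := fun _ => Bool) false c) c i
            (by simp) (by simp) hs h θ
          exact this.symm.trans (H _ _ _ hr)
    exact main n θ (by omega)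
  · intro hθ r c h hr
    have := fill_mem P k n 0 c h θ hθ
    rwa [truncRec_lt P (by omega), Submodule.mem_bot] at this

/-- The `k`-th truncation ideal of a unitary operad. -/
def truncIdeal (P : UnitaryOperad 𝕜) (k : ℕ) : P.OpIdeal where
  carrier := P.truncSubmodule k
  act_mem σ θ hθ := by
    rw [truncSubmodule_eq] at *
    exact truncRec_act P k σ θ hθ
  comp_mem_left h i μ ν hμ := by
    rw [truncSubmodule_eq] at *
    exact truncRec_comp_left P k h i μ ν hμ
  comp_mem_right h i μ ν hν := by
    rw [truncSubmodule_eq] at *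
    exact truncRec_comp_right P k h i μ ν hν

/-- The quotient of a unitary operad by its `k`-th truncation ideal. -/
abbrev modTrunc (P : UnitaryOperad 𝕜) (k : ℕ) : Operad 𝕜 := P.quotient (P.truncIdeal k)

end UnitaryOperad

/-! ### The operads of unital associative and of unital commutative algebras -/

section AsCom

variable (𝕜 : Type u) [CommRing 𝕜]

/-- The operad `As` of unital associative algebras: `As(n)` is the free module on the symmetric
group, with the action by right multiplication. -/
noncomputable def As : UnitaryOperad 𝕜 where
  obj n := Equiv.Perm (Fin n) →₀ 𝕜
  act σ := Finsupp.lmapDomain 𝕜 𝕜 (· * σ)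
  one := Finsupp.single 1 1
  comp h i := Finsupp.linearCombination 𝕜 fun φ => Finsupp.lmapDomain 𝕜 𝕜 (permComp h i φ)
  act_one θ := by
    induction θ using Finsupp.induction_linear with
    | zero => simp
    | add x y hx hy => rw [map_add, hx, hy]
    | single φ c => simp
  act_mul σ τ θ := by
    induction θ using Finsupp.induction_linear with
    | zero => simp
    | add x y hx hy => simp only [map_add, hx, hy]
    | single φ c => simp [mul_assoc]
  comp_one i θ := by
    induction θ using Finsupp.induction_linear with
    | zero => simp
    | add x y hx hy => simp only [map_add, LinearMap.add_apply, hx, hy]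
    | single φ c => simp [permComp_one_right]
  one_comp h θ := by
    induction θ using Finsupp.induction_linear with
    | zero => simp
    | add x y hx hy => simp only [map_add, hx, hy]
    | single φ c => simp [permComp_one_left]
  comp_assoc hp hr hq hr' i j a b c := by
    induction a using Finsupp.induction_linear with
    | zero => simp
    | add x y hx hy => simp only [map_add, LinearMap.add_apply, hx, hy]
    | single φ s =>
      induction b using Finsupp.induction_linear with
      | zero => simp
      | add x y hx hy => simp only [map_add, LinearMap.add_apply, hx, hy]
      | single σ t =>
        induction c using Finsupp.induction_linear with
        | zero => simp
        | add x y hx hy => simp only [map_add, hx, hy]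
        | single τ w => simp [permComp_assoc hp hr hq hr', mul_assoc, -Finsupp.single_mul]
  comp_comm hp hr hq hr' i j hij a b c := by
    induction a using Finsupp.induction_linear with
    | zero => simp
    | add x y hx hy => simp only [map_add, LinearMap.add_apply, hx, hy]
    | single φ s =>
      induction b using Finsupp.induction_linear with
      | zero => simp
      | add x y hx hy => simp only [map_add, LinearMap.add_apply, hx, hy]
      | single σ t =>
        induction c using Finsupp.induction_linear with
        | zero => simp
        | add x y hx hy => simp only [map_add, LinearMap.add_apply, hx, hy]
        | single τ w =>
          simp [permComp_comm hp hr hq hr' i j hij, mul_comm, mul_left_comm,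
            -Finsupp.single_mul]
  comp_act h i μ ν σ := by
    induction μ using Finsupp.induction_linear with
    | zero => simp
    | add x y hx hy => simp only [map_add, LinearMap.add_apply, hx, hy]
    | single φ s =>
      induction ν using Finsupp.induction_linear with
      | zero => simp
      | add x y hx hy => simp only [map_add, hx, hy]
      | single τ w => 
        have e := permComp_mul h i φ 1 τ σ
        rw [mul_one, Equiv.Perm.one_apply] at e
        simp [e, -Finsupp.single_mul]
  act_comp h i μ ν φ := by
    induction μ using Finsupp.induction_linear with
    | zero => simp
    | add x y hx hy => simp only [map_add, LinearMap.add_apply, hx, hy]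
    | single ψ s =>
      induction ν using Finsupp.induction_linear with
      | zero => simp
      | add x y hx hy => simp only [map_add, hx, hy]
      | single τ w => simp [← permComp_mul, -Finsupp.single_mul]
  unit0 := Finsupp.single 1 1
  unit0_basis := by
    constructor
    · intro a b hab
      simpa using DFunLike.congr_fun hab 1
    · intro θ
      refine ⟨θ 1, ?_⟩
      refine Finsupp.ext fun σ => ?_
      obtain rfl := Subsingleton.elim σ 1
      simp

/-- The operad `Com` of unital commutative algebras: `Com(n) = 𝕜` with trivial action, all partial
compositions being the multiplication of `𝕜`. -/
def Com : UnitaryOperad 𝕜 where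
  obj _ := 𝕜
  act _ := LinearMap.id
  one := (1 : 𝕜)
  comp _ _ := LinearMap.mul 𝕜 𝕜
  act_one _ := rfl
  act_mul _ _ _ := rfl
  comp_one _ θ := mul_one θ
  one_comp _ θ := one_mul θ
  comp_assoc _ _ _ _ _ _ a b c := mul_assoc a b c
  comp_comm _ _ _ _ _ _ _ a b c := mul_right_comm a b c
  comp_act _ _ _ _ _ := rfl
  act_comp _ _ _ _ _ := rfl
  unit0 := (1 : 𝕜)
  unit0_basis := ⟨fun a b h => by simpa using h, fun a => ⟨a, by simp⟩⟩

end AsCom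

/-! ### Operads presented by generators and relations -/

/-- Formal expressions in a collection `G` of generators: the terms of the language of operads
over `𝕜`. -/
inductive OpTerm (𝕜 : Type u) (G : ℕ → Type) : ℕ → Type u
  | gen {n : ℕ} (g : G n) : OpTerm 𝕜 G n
  | one : OpTerm 𝕜 G 1
  | zero (n : ℕ) : OpTerm 𝕜 G n
  | add {n : ℕ} (a b : OpTerm 𝕜 G n) : OpTerm 𝕜 G n
  | smul {n : ℕ} (c : 𝕜) (a : OpTerm 𝕜 G n) : OpTerm 𝕜 G n
  | act {n : ℕ} (σ : Equiv.Perm (Fin n)) (a : OpTerm 𝕜 G n) : OpTerm 𝕜 G n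
  | comp {m n r : ℕ} (h : m + n = r + 1) (i : Fin m) (a : OpTerm 𝕜 G m) (b : OpTerm 𝕜 G n) :
      OpTerm 𝕜 G r

/-- The congruence on formal expressions generated by the relations `R` and by the axioms of an
operad. -/
inductive OpRel {𝕜 : Type u} [CommRing 𝕜] {G : ℕ → Type}
    (R : ∀ n, OpTerm 𝕜 G n → OpTerm 𝕜 G n → Prop) :
    ∀ {n : ℕ}, OpTerm 𝕜 G n → OpTerm 𝕜 G n → Prop
  | of {n} {a b : OpTerm 𝕜 G n} : R n a b → OpRel R a b
  | refl {n} (a : OpTerm 𝕜 G n) : OpRel R a a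
  | symm {n} {a b : OpTerm 𝕜 G n} : OpRel R a b → OpRel R b a
  | trans {n} {a b c : OpTerm 𝕜 G n} : OpRel R a b → OpRel R b c → OpRel R a c
  | add_congr {n} {a a' b b' : OpTerm 𝕜 G n} : OpRel R a a' → OpRel R b b' →
      OpRel R (.add a b) (.add a' b')
  | smul_congr {n} (c : 𝕜) {a a' : OpTerm 𝕜 G n} : OpRel R a a' →
      OpRel R (.smul c a) (.smul c a')
  | act_congr {n} (σ : Equiv.Perm (Fin n)) {a a' : OpTerm 𝕜 G n} : OpRel R a a' →
      OpRel R (.act σ a) (.act σ a')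
  | comp_congr {m n r} (h : m + n = r + 1) (i : Fin m) {a a' : OpTerm 𝕜 G m}
      {b b' : OpTerm 𝕜 G n} : OpRel R a a' → OpRel R b b' →
      OpRel R (.comp h i a b) (.comp h i a' b')
  | add_assoc {n} (a b c : OpTerm 𝕜 G n) :
      OpRel R (.add (.add a b) c) (.add a (.add b c))
  | add_comm {n} (a b : OpTerm 𝕜 G n) : OpRel R (.add a b) (.add b a)
  | zero_add {n} (a : OpTerm 𝕜 G n) : OpRel R (.add (.zero n) a) a
  | neg_add {n} (a : OpTerm 𝕜 G n) : OpRel R (.add (.smul (-1) a) a) (.zero n)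
  | one_smul {n} (a : OpTerm 𝕜 G n) : OpRel R (.smul 1 a) a
  | mul_smul {n} (c d : 𝕜) (a : OpTerm 𝕜 G n) :
      OpRel R (.smul (c * d) a) (.smul c (.smul d a))
  | add_smul {n} (c d : 𝕜) (a : OpTerm 𝕜 G n) :
      OpRel R (.smul (c + d) a) (.add (.smul c a) (.smul d a))
  | smul_add {n} (c : 𝕜) (a b : OpTerm 𝕜 G n) :
      OpRel R (.smul c (.add a b)) (.add (.smul c a) (.smul c b))
  | act_add {n} (σ : Equiv.Perm (Fin n)) (a b : OpTerm 𝕜 G n) :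
      OpRel R (.act σ (.add a b)) (.add (.act σ a) (.act σ b))
  | act_smul {n} (σ : Equiv.Perm (Fin n)) (c : 𝕜) (a : OpTerm 𝕜 G n) :
      OpRel R (.act σ (.smul c a)) (.smul c (.act σ a))
  | comp_add {m n r} (h : m + n = r + 1) (i : Fin m) (a : OpTerm 𝕜 G m) (b b' : OpTerm 𝕜 G n) :
      OpRel R (.comp h i a (.add b b')) (.add (.comp h i a b) (.comp h i a b'))
  | comp_smul {m n r} (h : m + n = r + 1) (i : Fin m) (c : 𝕜) (a : OpTerm 𝕜 G m)
      (b : OpTerm 𝕜 G n) : OpRel R (.comp h i a (.smul c b)) (.smul c (.comp h i a b))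
  | add_comp {m n r} (h : m + n = r + 1) (i : Fin m) (a a' : OpTerm 𝕜 G m) (b : OpTerm 𝕜 G n) :
      OpRel R (.comp h i (.add a a') b) (.add (.comp h i a b) (.comp h i a' b))
  | smul_comp {m n r} (h : m + n = r + 1) (i : Fin m) (c : 𝕜) (a : OpTerm 𝕜 G m)
      (b : OpTerm 𝕜 G n) : OpRel R (.comp h i (.smul c a) b) (.smul c (.comp h i a b))
  | act_one {n} (a : OpTerm 𝕜 G n) : OpRel R (.act 1 a) a
  | act_mul {n} (σ τ : Equiv.Perm (Fin n)) (a : OpTerm 𝕜 G n) :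
      OpRel R (.act (σ * τ) a) (.act τ (.act σ a))
  | comp_one {n} (i : Fin n) (a : OpTerm 𝕜 G n) : OpRel R (.comp rfl i a .one) a
  | one_comp {n} (h : 1 + n = n + 1) (a : OpTerm 𝕜 G n) : OpRel R (.comp h 0 .one a) a
  | comp_assoc {l m n p q r} (hp : l + m = p + 1) (hr : p + n = r + 1)
      (hq : m + n = q + 1) (hr' : l + q = r + 1) (i : Fin l) (j : Fin m)
      (a : OpTerm 𝕜 G l) (b : OpTerm 𝕜 G m) (c : OpTerm 𝕜 G n) :
      OpRel R (.comp hr ⟨i + j, by omega⟩ (.comp hp i a b) c) (.comp hr' i a (.comp hq j b c))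
  | comp_comm {l m n p q r} (hp : l + m = p + 1) (hr : p + n = r + 1)
      (hq : l + n = q + 1) (hr' : q + m = r + 1) (i j : Fin l) (_ : i < j)
      (a : OpTerm 𝕜 G l) (b : OpTerm 𝕜 G m) (c : OpTerm 𝕜 G n) :
      OpRel R (.comp hr ⟨j + m - 1, by omega⟩ (.comp hp i a b) c)
        (.comp hr' ⟨i, by omega⟩ (.comp hq j a c) b)
  | comp_act {m n r} (h : m + n = r + 1) (i : Fin m) (a : OpTerm 𝕜 G m) (b : OpTerm 𝕜 G n)
      (σ : Equiv.Perm (Fin n)) :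
      OpRel R (.comp h i a (.act σ b)) (.act (permComp h i 1 σ) (.comp h i a b))
  | act_comp {m n r} (h : m + n = r + 1) (i : Fin m) (a : OpTerm 𝕜 G m) (b : OpTerm 𝕜 G n)
      (φ : Equiv.Perm (Fin m)) :
      OpRel R (.comp h i (.act φ a) b) (.act (permComp h i φ 1) (.comp h (φ i) a b))

section Presented

variable {𝕜 : Type u} [CommRing 𝕜] {G : ℕ → Type}
  (R : ∀ n, OpTerm 𝕜 G n → OpTerm 𝕜 G n → Prop)

def opSetoid (n : ℕ) : Setoid (OpTerm 𝕜 G n) :=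
  ⟨OpRel R, .refl, .symm, .trans⟩

/-- Operations of arity `n` of the operad with generators `G` and relations `R`. -/
def PresentedObj (n : ℕ) : Type u := Quotient (opSetoid R n)

namespace PresentedObj

variable {R}

instance (n : ℕ) : Add (PresentedObj R n) :=
  ⟨Quotient.map₂ OpTerm.add fun _ _ h _ _ h' => OpRel.add_congr h h'⟩

instance (n : ℕ) : Zero (PresentedObj R n) := ⟨Quotient.mk _ (.zero n)⟩

instance (n : ℕ) : Neg (PresentedObj R n) :=
  ⟨Quotient.map (OpTerm.smul (-1)) fun _ _ h => OpRel.smul_congr _ h⟩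

instance (n : ℕ) : AddCommGroup (PresentedObj R n) where
  nsmul := nsmulRec
  zsmul := zsmulRec
  add_assoc := by
    rintro ⟨a⟩ ⟨b⟩ ⟨c⟩; exact Quotient.sound (.add_assoc a b c)
  add_comm := by
    rintro ⟨a⟩ ⟨b⟩; exact Quotient.sound (.add_comm a b)
  zero_add := by
    rintro ⟨a⟩; exact Quotient.sound (.zero_add a)
  add_zero := by
    rintro ⟨a⟩; exact Quotient.sound (.trans (.add_comm a _) (.zero_add a))
  neg_add_cancel := by
    rintro ⟨a⟩; exact Quotient.sound (.neg_add a)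

instance (n : ℕ) : Module 𝕜 (PresentedObj R n) where
  smul c := Quotient.map (OpTerm.smul c) fun _ _ h => OpRel.smul_congr c h
  one_smul := by
    rintro ⟨a⟩; exact Quotient.sound (.one_smul a)
  mul_smul := by
    rintro c d ⟨a⟩; exact Quotient.sound (.mul_smul c d a)
  smul_zero c := by
    let z : PresentedObj R n := Quotient.mk _ (OpTerm.smul c (.zero n))
    have h : z = z + z := Quotient.sound (s := opSetoid R n)
      (OpRel.trans (OpRel.smul_congr c (OpRel.symm (OpRel.zero_add _))) (OpRel.smul_add c _ _))
    exact left_eq_add.mp h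
  smul_add := by
    rintro c ⟨a⟩ ⟨b⟩; exact Quotient.sound (.smul_add c a b)
  add_smul := by
    rintro c d ⟨a⟩; exact Quotient.sound (.add_smul c d a)
  zero_smul := by
    rintro ⟨a⟩
    let z : PresentedObj R n := Quotient.mk _ (OpTerm.smul (0 : 𝕜) a)
    have e : OpRel R (.smul ((0 : 𝕜) + 0) a) (.add (.smul 0 a) (.smul 0 a)) :=
      OpRel.add_smul 0 0 a
    rw [_root_.zero_add] at e
    have h : z = z + z := Quotient.sound (s := opSetoid R n) e
    exact left_eq_add.mp h

end PresentedObj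

/-- The operad with generators `G` and relations `R`. -/
def presented : Operad 𝕜 where
  obj := PresentedObj R
  act σ :=
    { toFun := Quotient.map (OpTerm.act σ) fun _ _ h => OpRel.act_congr σ h
      map_add' := by rintro ⟨a⟩ ⟨b⟩; exact Quotient.sound (.act_add σ a b)
      map_smul' := by rintro c ⟨a⟩; exact Quotient.sound (.act_smul σ c a) }
  one := Quotient.mk _ .one
  comp h i := LinearMap.mk₂ 𝕜
    (Quotient.map₂ (OpTerm.comp h i) fun _ _ e _ _ e' => OpRel.comp_congr h i e e')
    (by rintro ⟨a⟩ ⟨a'⟩ ⟨b⟩; exact Quotient.sound (.add_comp h i a a' b))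
    (by rintro c ⟨a⟩ ⟨b⟩; exact Quotient.sound (.smul_comp h i c a b))
    (by rintro ⟨a⟩ ⟨b⟩ ⟨b'⟩; exact Quotient.sound (.comp_add h i a b b'))
    (by rintro c ⟨a⟩ ⟨b⟩; exact Quotient.sound (.comp_smul h i c a b))
  act_one := by rintro n ⟨a⟩; exact Quotient.sound (.act_one a)
  act_mul := by rintro n σ τ ⟨a⟩; exact Quotient.sound (.act_mul σ τ a)
  comp_one := by rintro n i ⟨a⟩; exact Quotient.sound (.comp_one i a)
  one_comp := by rintro n h ⟨a⟩; exact Quotient.sound (.one_comp h a)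
  comp_assoc := by
    rintro l m n p q r hp hr hq hr' i j ⟨a⟩ ⟨b⟩ ⟨c⟩
    exact Quotient.sound (.comp_assoc hp hr hq hr' i j a b c)
  comp_comm := by
    rintro l m n p q r hp hr hq hr' i j hij ⟨a⟩ ⟨b⟩ ⟨c⟩
    exact Quotient.sound (.comp_comm hp hr hq hr' i j hij a b c)
  comp_act := by
    rintro m n r h i ⟨a⟩ ⟨b⟩ σ; exact Quotient.sound (.comp_act h i a b σ)
  act_comp := by
    rintro m n r h i ⟨a⟩ ⟨b⟩ φ; exact Quotient.sound (.act_comp h i a b φ)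

/-- The class of an expression in the presented operad. -/
def presentedMk {n : ℕ} (t : OpTerm 𝕜 G n) : (presented R).obj n := Quotient.mk _ t

variable {R}

/-- Evaluation of expressions in an operad. -/
def OpTerm.eval (Q : Operad 𝕜) (g : ∀ n, G n → Q.obj n) : ∀ {n : ℕ}, OpTerm 𝕜 G n → Q.obj n
  | _, .gen x => g _ x
  | _, .one => Q.one
  | _, .zero _ => 0
  | _, .add a b => a.eval Q g + b.eval Q g
  | _, .smul c a => c • a.eval Q g
  | _, .act σ a => Q.act σ (a.eval Q g)
  | _, .comp h i a b => Q.comp h i (a.eval Q g) (b.eval Q g)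

theorem OpRel.eval_eq (Q : Operad 𝕜) (g : ∀ n, G n → Q.obj n)
    (hR : ∀ n a b, R n a b → a.eval Q g = b.eval Q g) {n : ℕ} {a b : OpTerm 𝕜 G n}
    (h : OpRel R a b) : a.eval Q g = b.eval Q g := by
  induction h with
  | of h => exact hR _ _ _ h
  | refl => rfl
  | symm _ ih => exact ih.symm
  | trans _ _ ih ih' => exact ih.trans ih'
  | add_congr _ _ ih ih' => simp only [OpTerm.eval, ih, ih']
  | smul_congr _ _ ih => simp only [OpTerm.eval, ih]
  | act_congr _ _ ih => simp only [OpTerm.eval, ih]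
  | comp_congr _ _ _ _ ih ih' => simp only [OpTerm.eval, ih, ih']
  | add_assoc => exact _root_.add_assoc _ _ _
  | add_comm => exact _root_.add_comm _ _
  | zero_add => exact _root_.zero_add _
  | neg_add => simp [OpTerm.eval]
  | one_smul => exact _root_.one_smul _ _
  | mul_smul => exact SemigroupAction.mul_smul _ _ _
  | add_smul => exact _root_.add_smul _ _ _
  | smul_add => exact _root_.smul_add _ _ _
  | act_add => simp [OpTerm.eval]
  | act_smul => simp [OpTerm.eval]
  | comp_add => simp [OpTerm.eval]
  | comp_smul => simp [OpTerm.eval]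
  | add_comp => simp [OpTerm.eval]
  | smul_comp => simp [OpTerm.eval]
  | act_one => exact Q.act_one _
  | act_mul => exact Q.act_mul _ _ _
  | comp_one => exact Q.comp_one _ _
  | one_comp => exact Q.one_comp _ _
  | comp_assoc hp hr hq hr' i j => exact Q.comp_assoc hp hr hq hr' i j _ _ _
  | comp_comm hp hr hq hr' i j hij => exact Q.comp_comm hp hr hq hr' i j hij _ _ _
  | comp_act => exact Q.comp_act _ _ _ _ _
  | act_comp => exact Q.act_comp _ _ _ _ _

/-- The universal property of the presented operad: elements of an operad `Q` that satisfy the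
relations define a morphism to `Q`. -/
def presentedLift (Q : Operad 𝕜) (g : ∀ n, G n → Q.obj n)
    (hR : ∀ n a b, R n a b → a.eval Q g = b.eval Q g) : OperadHom (presented R) Q where
  toFun n :=
    { toFun := Quotient.lift (fun t => OpTerm.eval Q g t) fun _ _ h => OpRel.eval_eq Q g hR h
      map_add' := by rintro ⟨a⟩ ⟨b⟩; rfl
      map_smul' := by rintro c ⟨a⟩; rfl }
  map_one := rfl
  map_act := by rintro n σ ⟨a⟩; rfl
  map_comp := by rintro m n r h i ⟨a⟩ ⟨b⟩; rfl

end Presented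

/-! ### The operad of unital commutative Poisson algebras -/

/-- The generators of `Pois`: the unit, the product and the bracket. -/
inductive PoisGen : ℕ → Type
  | unit : PoisGen 0
  | mul : PoisGen 2
  | br : PoisGen 2

section Pois

variable (𝕜 : Type u) [CommRing 𝕜]

/-- The unit, the product and the bracket as expressions. -/
abbrev unitT : OpTerm 𝕜 PoisGen 0 := .gen .unit
abbrev mulT : OpTerm 𝕜 PoisGen 2 := .gen .mul
abbrev brT : OpTerm 𝕜 PoisGen 2 := .gen .br

/-- The defining relations of `Pois`. The variables of an operation are numbered from `0`, and the
transposition is the one of the first two variables. -/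
inductive PoisRel : ∀ n : ℕ, OpTerm 𝕜 PoisGen n → OpTerm 𝕜 PoisGen n → Prop
  /-- `1 · x = x` and `x · 1 = x` -/
  | mul_unit (i : Fin 2) : PoisRel 1 (.comp (m := 2) (n := 0) rfl i (mulT 𝕜) (unitT 𝕜)) .one
  /-- `[1, x] = 0` and `[x, 1] = 0` -/
  | br_unit (i : Fin 2) : PoisRel 1 (.comp (m := 2) (n := 0) rfl i (brT 𝕜) (unitT 𝕜)) (.zero 1)
  /-- `y · x = x · y` -/
  | mul_comm : PoisRel 2 (.act (Equiv.swap 0 1) (mulT 𝕜)) (mulT 𝕜)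
  /-- `[y, x] = -[x, y]` -/
  | br_skew : PoisRel 2 (.act (Equiv.swap 0 1) (brT 𝕜)) (.smul (-1) (brT 𝕜))
  /-- `(x · y) · z = x · (y · z)` -/
  | mul_assoc : PoisRel 3 (.comp (m := 2) (n := 2) rfl 0 (mulT 𝕜) (mulT 𝕜)) (.comp (m := 2) (n := 2) rfl 1 (mulT 𝕜) (mulT 𝕜))
  /-- `[x · y, z] = x · [y, z] + y · [x, z]` -/
  | leibniz : PoisRel 3 (.comp (m := 2) (n := 2) rfl 0 (brT 𝕜) (mulT 𝕜))
      (.add (.comp (m := 2) (n := 2) rfl 1 (mulT 𝕜) (brT 𝕜))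
        (.act (Equiv.swap 0 1) (.comp (m := 2) (n := 2) rfl 1 (mulT 𝕜) (brT 𝕜))))
  /-- `[x, [y, z]] = [[x, y], z] + [y, [x, z]]` -/
  | jacobi : PoisRel 3 (.comp (m := 2) (n := 2) rfl 1 (brT 𝕜) (brT 𝕜))
      (.add (.comp (m := 2) (n := 2) rfl 0 (brT 𝕜) (brT 𝕜))
        (.act (Equiv.swap 0 1) (.comp (m := 2) (n := 2) rfl 1 (brT 𝕜) (brT 𝕜))))

/-- The operad `Pois` of unital commutative Poisson algebras, without its unitary structure. -/
abbrev PoisOperad : Operad 𝕜 := presented (PoisRel 𝕜)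

variable {𝕜}

/-- The operations all of whose full substitutions of `e` are multiples of `e`. -/
def scalarRec (P : Operad 𝕜) (e : P.obj 0) : ∀ n, Submodule 𝕜 (P.obj n)
  | 0 => Submodule.span 𝕜 {e}
  | n + 1 => ⨅ i : Fin (n + 1), (scalarRec P e n).comap
      ((P.comp (m := n + 1) (n := 0) (r := n) rfl i).flip e)

theorem mem_scalarRec (P : Operad 𝕜) (e : P.obj 0) {n m : ℕ} (h : m + 0 = n + 1) (θ : P.obj m) :
    θ ∈ scalarRec P e m ↔ ∀ i, P.comp h i θ e ∈ scalarRec P e n := by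
  obtain rfl : m = n + 1 := h
  simp [scalarRec]

theorem scalarRec_act (P : Operad 𝕜) (e : P.obj 0) {n : ℕ} (σ : Equiv.Perm (Fin n))
    (θ : P.obj n) (hθ : θ ∈ scalarRec P e n) : P.act σ θ ∈ scalarRec P e n := by
  induction n with
  | zero => rwa [Subsingleton.elim σ 1, P.act_one]
  | succ n ih =>
    rw [mem_scalarRec P e rfl] at *
    intro i
    rw [P.act_comp]
    exact ih _ _ (hθ _)

theorem scalarRec_comp (P : Operad 𝕜) (e : P.obj 0) : ∀ {r m n : ℕ} (h : m + n = r + 1)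
    (i : Fin m) (μ : P.obj m) (ν : P.obj n), μ ∈ scalarRec P e m → ν ∈ scalarRec P e n →
    P.comp h i μ ν ∈ scalarRec P e r := by
  have base : ∀ {r m : ℕ} (h : m + 0 = r + 1) (i : Fin m) (μ : P.obj m) (ν : P.obj 0),
      μ ∈ scalarRec P e m → ν ∈ scalarRec P e 0 → P.comp h i μ ν ∈ scalarRec P e r := by
    intro r m h i μ ν hμ hν
    obtain ⟨c, rfl⟩ := Submodule.mem_span_singleton.mp hν
    rw [map_smul]
    exact Submodule.smul_mem _ _ ((mem_scalarRec P e h _).mp hμ i)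
  intro r
  induction r with
  | zero =>
    intro m n h i μ ν hμ hν
    obtain rfl : n = 0 := by have := i.2; omega
    exact base h i μ ν hμ hν
  | succ r ih =>
    intro m n h i μ ν hμ hν
    rcases Nat.eq_zero_or_pos n with rfl | hn
    · exact base h i μ ν hμ hν
    · rw [mem_scalarRec P e (n := r) rfl]
      intro x
      rcases pos_cases h i x with ⟨a, ha, rfl⟩ | ⟨b, rfl⟩
      · have ha' := Fin.val_ne_of_ne ha
        rcases lt_or_gt_of_ne ha with hlt | hlt
        · have hlt' : a.1 < i.1 := hlt
          have := P.comp_comm (l := m) (m := 0) (n := n) (p := m - 1) (q := r + 1) (r := r)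
            (by omega) (by omega) h rfl a i hlt μ e ν
          have e' : outerPos h i a ha = ⟨a, by omega⟩ := by
            ext; simp [outerPos_val, shift, hlt']
          rw [e', ← this]
          exact ih _ _ _ _ ((mem_scalarRec P e _ _).mp hμ _) hν
        · have hlt' : i.1 < a.1 := hlt
          have := P.comp_comm (l := m) (m := n) (n := 0) (p := r + 1) (q := m - 1) (r := r)
            h rfl (by omega) (by omega) i a hlt μ ν e
          have e' : outerPos h i a ha = ⟨a + n - 1, by omega⟩ := by
            ext; simp [outerPos_val, shift, not_lt.mpr hlt'.le]
          rw [e', this]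
          exact ih _ _ _ _ ((mem_scalarRec P e _ _).mp hμ _) hν
      · have := P.comp_assoc (l := m) (m := n) (n := 0) (p := r + 1) (q := n - 1) (r := r)
          h rfl (by omega) (by omega) i b μ ν e
        have e' : innerPos h i b = ⟨i + b, by omega⟩ := rfl
        rw [e', this]
        exact ih _ _ _ _ hμ ((mem_scalarRec P e _ _).mp hν b)

theorem one_mem_scalarRec (P : Operad 𝕜) (e : P.obj 0) : P.one ∈ scalarRec P e 1 := by
  rw [mem_scalarRec P e (n := 0) rfl]
  intro i
  obtain rfl : i = 0 := Subsingleton.elim _ _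
  rw [P.one_comp]
  exact Submodule.mem_span_singleton_self e

theorem pois_mem_scalarRec {n : ℕ} (t : OpTerm 𝕜 PoisGen n) :
    presentedMk (PoisRel 𝕜) t ∈
      scalarRec (PoisOperad 𝕜) (presentedMk (PoisRel 𝕜) (unitT 𝕜)) n := by
  induction t with
  | gen g =>
    cases g with
    | unit => exact Submodule.mem_span_singleton_self _
    | mul =>
      rw [mem_scalarRec _ _ (n := 1) rfl]
      intro i
      have : (PoisOperad 𝕜).comp (m := 2) (n := 0) (r := 1) rfl i (presentedMk (PoisRel 𝕜) (mulT 𝕜))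
          (presentedMk (PoisRel 𝕜) (unitT 𝕜)) = (PoisOperad 𝕜).one :=
        Quotient.sound (.of (.mul_unit i))
      exact this ▸ one_mem_scalarRec _ _
    | br =>
      rw [mem_scalarRec _ _ (n := 1) rfl]
      intro i
      have : (PoisOperad 𝕜).comp (m := 2) (n := 0) (r := 1) rfl i (presentedMk (PoisRel 𝕜) (brT 𝕜))
          (presentedMk (PoisRel 𝕜) (unitT 𝕜)) = 0 :=
        Quotient.sound (.of (.br_unit i))
      exact this ▸ zero_mem _
  | one => exact one_mem_scalarRec _ _
  | zero n => exact zero_mem _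
  | add a b iha ihb => exact add_mem iha ihb
  | smul c a ih => exact Submodule.smul_mem _ c ih
  | act σ a ih => exact scalarRec_act _ _ σ _ ih
  | comp h i a b iha ihb => exact scalarRec_comp _ _ h i _ _ iha ihb

/-- The morphism `Pois → Com` killing the bracket. -/
def poisToCom : OperadHom (PoisOperad 𝕜) (Com 𝕜).toOperad :=
  presentedLift (Com 𝕜).toOperad
    (fun _ g => match g with
      | .unit => (1 : 𝕜)
      | .mul => (1 : 𝕜)
      | .br => (0 : 𝕜))
    (by
      intro n a b h
      cases h with
      | mul_unit i => exact mul_one (1 : 𝕜)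
      | br_unit i => exact zero_mul (1 : 𝕜)
      | mul_comm => rfl
      | br_skew => exact (mul_zero (-1 : 𝕜)).symm
      | mul_assoc => rfl
      | leibniz => exact (by simp : (0 : 𝕜) * 1 = 1 * 0 + 1 * 0)
      | jacobi => exact (by simp : (0 : 𝕜) * 0 = 0 * 0 + 0 * 0))

variable (𝕜)

/-- The operad `Pois` of unital commutative Poisson algebras. -/
def Pois : UnitaryOperad 𝕜 where
  toOperad := PoisOperad 𝕜
  unit0 := presentedMk (PoisRel 𝕜) (unitT 𝕜)
  unit0_basis := by
    constructor
    · intro a b hab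
      have h := congrArg (poisToCom.toFun 0) hab
      simp only [map_smul] at h
      have h1 : poisToCom.toFun 0 (presentedMk (PoisRel 𝕜) (unitT 𝕜)) = (1 : 𝕜) := rfl
      rw [h1] at h
      exact (mul_one a).symm.trans ((h : a * 1 = b * 1).trans (mul_one b))
    · rintro ⟨t⟩
      exact Submodule.mem_span_singleton.mp (pois_mem_scalarRec t)

end Pois

end Operadic

open Operadic

/-!
`Com` is its own first and second truncation. The role of `Com` for the third truncation is played
by the square-zero extension `Alt` of `Com` by the alternating functions of two slots, which has a
commutative product, an antisymmetric bracket, and no operations in the third truncation ideal. An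
operation outside a truncation ideal is detected by substituting the unit `𝟏₀` down to low arities,
so a morphism onto `Com` or `Alt` that is bijective in low arities identifies it with a truncation;
this applies to `Pois`, and to `As` as soon as `2` is invertible, the product of `As` being sent to
the product of `Alt` plus half of the bracket.

Modulo inner derivations a derivation kills `𝟏₀`, and a derivation that kills `𝟏₀` is determined in
a truncation by its values in low arities. For `Alt` only the scaling of the bracket remains.

An isomorphism of truncations carries the product of `Pois` to a commutative operation of arity two
in `As`, which is a multiple `a (x y + y x)` of the anticommutator. That it has a unit forces `2 a`
to be invertible, and if the truncation retains arity three it is associative, which forces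
`2 a² = 0`.
-/

namespace Operadic

section Morphisms

variable {𝕜 : Type u} [CommRing 𝕜] {P Q R : Operad 𝕜}

/-- The composite of two morphisms of operads. -/
def OperadHom.trans (f : OperadHom P Q) (g : OperadHom Q R) : OperadHom P R where
  toFun n := g.toFun n ∘ₗ f.toFun n
  map_one := by simp only [LinearMap.comp_apply, f.map_one, g.map_one]
  map_act σ θ := by simp only [LinearMap.comp_apply, f.map_act, g.map_act]
  map_comp h i μ ν := by simp only [LinearMap.comp_apply, f.map_comp, g.map_comp]

namespace OperadIso

theorem trans (h : OperadIso P Q) (h' : OperadIso Q R) : OperadIso P R :=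
  let ⟨f, hf⟩ := h
  let ⟨g, hg⟩ := h'
  ⟨f.trans g, fun n => (hg n).comp (hf n)⟩

theorem symm (h : OperadIso P Q) : OperadIso Q P := by
  obtain ⟨f, hf⟩ := h
  let e n : P.obj n ≃ₗ[𝕜] Q.obj n := LinearEquiv.ofBijective (f.toFun n) (hf n)
  have apply_symm n θ : f.toFun n ((e n).symm.toLinearMap θ) = θ := (e n).apply_symm_apply θ
  refine ⟨⟨fun n => (e n).symm, ?_, fun σ θ => ?_, fun h i μ ν => ?_⟩,
    fun n => (e n).symm.bijective⟩ <;> refine (hf _).1 ?_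
  · rw [apply_symm, f.map_one]
  · rw [apply_symm, f.map_act, apply_symm]
  · rw [apply_symm, f.map_comp, apply_symm, apply_symm]

end OperadIso

/-- The family of linear maps defining the inner derivation attached to a unary operation. -/
def Operad.innerMap (P : Operad 𝕜) (a : P.obj 1) (n : ℕ) : P.obj n →ₗ[𝕜] P.obj n :=
  P.comp (Nat.add_comm 1 n) 0 a - ∑ i : Fin n, (P.comp rfl i).flip a

theorem Operad.innerMap_apply (a : P.obj 1) (n : ℕ) (θ : P.obj n) :
    P.innerMap a n θ = P.comp (Nat.add_comm 1 n) 0 a θ - ∑ i : Fin n, P.comp rfl i θ a := by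
  simp only [innerMap, LinearMap.sub_apply, LinearMap.sum_apply, LinearMap.flip_apply]

theorem Operad.mem_innerDer_iff (d : P.der) : d ∈ P.innerDer ↔ ∃ a, d.1 = P.innerMap a := by
  refine exists_congr fun a => ⟨fun h => ?_, fun h n θ => ?_⟩
  · ext n θ
    rw [h, Operad.innerMap_apply]
  · rw [h, Operad.innerMap_apply]

namespace OperadHom

variable (f : OperadHom P Q)

theorem map_innerMap (a : P.obj 1) (n : ℕ) (θ : P.obj n) :
    f.toFun n (P.innerMap a n θ) = Q.innerMap (f.toFun 1 a) n (f.toFun n θ) := by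
  simp only [Operad.innerMap_apply, map_sub, map_sum, f.map_comp]

variable (hf : ∀ n, Function.Bijective (f.toFun n))

/-- The transport along an isomorphism of operads of families of endomorphisms of the
components. -/
noncomputable def conj : (∀ n, P.obj n →ₗ[𝕜] P.obj n) ≃ₗ[𝕜] ∀ n, Q.obj n →ₗ[𝕜] Q.obj n :=
  LinearEquiv.piCongrRight fun n => (LinearEquiv.ofBijective (f.toFun n) (hf n)).conj

theorem conj_apply (d : ∀ n, P.obj n →ₗ[𝕜] P.obj n) (n : ℕ) (θ : P.obj n) :
    f.conj hf d n (f.toFun n θ) = f.toFun n (d n θ) := by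
  let e := LinearEquiv.ofBijective (f.toFun n) (hf n)
  exact congrArg (fun x => f.toFun n (d n x)) (e.symm_apply_apply θ)

theorem conj_mem_der_iff (d : ∀ n, P.obj n →ₗ[𝕜] P.obj n) : f.conj hf d ∈ Q.der ↔ d ∈ P.der := by
  constructor
  · rintro ⟨hact, hcomp⟩
    refine ⟨fun n σ θ => (hf n).1 ?_, fun m n r h i μ ν => (hf r).1 ?_⟩
    · rw [f.map_act, ← f.conj_apply hf, ← f.conj_apply hf, f.map_act, hact]
    · simp only [map_add, f.map_comp, ← f.conj_apply hf, hcomp]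
  · rintro ⟨hact, hcomp⟩
    refine ⟨fun n σ θ => ?_, fun m n r h i μ ν => ?_⟩
    · obtain ⟨θ, rfl⟩ := (hf n).2 θ
      rw [← f.map_act, f.conj_apply, f.conj_apply, hact, f.map_act]
    · obtain ⟨μ, rfl⟩ := (hf m).2 μ
      obtain ⟨ν, rfl⟩ := (hf n).2 ν
      simp only [← f.map_comp, f.conj_apply, hcomp, map_add]

theorem conj_innerMap (a : P.obj 1) : f.conj hf (P.innerMap a) = Q.innerMap (f.toFun 1 a) := by
  ext n θ
  obtain ⟨θ, rfl⟩ := (hf n).2 θ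
  rw [f.conj_apply, f.map_innerMap]

end OperadHom

theorem OperadIso.nonempty_h1_equiv (h : OperadIso P Q) : Nonempty (P.H1 ≃ₗ[𝕜] Q.H1) := by
  obtain ⟨f, hf⟩ := h
  let c := f.conj hf
  have map_der : P.der.map c.toLinearMap = Q.der := by
    rw [← Submodule.map_comap_eq_of_surjective (f := c.toLinearMap) c.surjective Q.der]
    exact congrArg _ (Submodule.ext fun d => (f.conj_mem_der_iff hf d).symm)
  let e : P.der ≃ₗ[𝕜] Q.der := c.ofSubmodules P.der Q.der map_der
  refine ⟨Submodule.Quotient.equiv P.innerDer Q.innerDer e ?_⟩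
  have mem_inner d : e d ∈ Q.innerDer ↔ d ∈ P.innerDer := by
    rw [Operad.mem_innerDer_iff, Operad.mem_innerDer_iff, (hf 1).2.exists]
    refine exists_congr fun a => ?_
    rw [← f.conj_innerMap hf]
    exact c.injective.eq_iff
  ext d
  obtain ⟨d, rfl⟩ := e.surjective d
  rw [mem_inner]
  exact e.injective.mem_set_image

end Morphisms

namespace UnitaryOperad

variable {𝕜 : Type u} [CommRing 𝕜] {P Q : UnitaryOperad 𝕜} {k : ℕ}

/-- A unitary operad is `k`-truncated if its `k`-th truncation ideal vanishes. -/
def IsTruncated (P : UnitaryOperad 𝕜) (k : ℕ) : Prop :=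
  ∀ n, P.truncSubmodule k n = ⊥

theorem isTruncated_iff (hk : 0 < k) : P.IsTruncated k ↔ ∀ n, k ≤ n + 1 → ∀ θ : P.obj (n + 1),
    (∀ i, P.comp (n := 0) rfl i θ P.unit0 = 0) → θ = 0 := by
  simp only [IsTruncated, truncSubmodule_eq]
  refine ⟨fun hP n hn θ hθ => ?_, fun H n => ?_⟩
  · have : θ ∈ P.truncRec k (n + 1) := by
      rw [mem_truncRec P rfl hn]
      intro i
      rw [hθ]
      exact zero_mem _
    rwa [hP, Submodule.mem_bot] at this
  · induction n with
    | zero => exact truncRec_lt P hk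
    | succ n ih =>
      rcases lt_or_ge (n + 1) k with hn | hn
      · exact truncRec_lt P hn
      · refine (Submodule.eq_bot_iff _).mpr fun θ hθ => H n hn θ fun i => ?_
        simpa only [ih, Submodule.mem_bot] using (mem_truncRec P rfl hn θ).mp hθ i

theorem map_mem_truncSubmodule_iff (F : OperadHom P.toOperad Q.toOperad)
    (h0 : F.toFun 0 P.unit0 = Q.unit0) (hinj : ∀ n < k, Function.Injective (F.toFun n)) {n : ℕ}
    (θ : P.obj n) : F.toFun n θ ∈ Q.truncSubmodule k n ↔ θ ∈ P.truncSubmodule k n := by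
  simp only [truncSubmodule_eq]
  have low : ∀ n < k, ∀ θ : P.obj n,
      F.toFun n θ ∈ Q.truncRec k n ↔ θ ∈ P.truncRec k n := by
    intro n hn θ
    rw [truncRec_lt P hn, truncRec_lt Q hn, Submodule.mem_bot, Submodule.mem_bot]
    exact map_eq_zero_iff _ (hinj n hn)
  induction n with
  | zero =>
    rcases Nat.eq_zero_or_pos k with rfl | hk
    · simp only [truncRec_zero, Submodule.mem_top]
    · exact low 0 hk θ
  | succ n ih =>
    rcases lt_or_ge (n + 1) k with hn | hn
    · exact low _ hn θ
    · rw [mem_truncRec P rfl hn, mem_truncRec Q rfl hn]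
      refine forall_congr' fun i => ?_
      have := ih (P.comp (n := 0) rfl i θ P.unit0)
      rwa [F.map_comp, h0] at this

theorem modTrunc_iso_of_isTruncated (F : OperadHom P.toOperad Q.toOperad)
    (h0 : F.toFun 0 P.unit0 = Q.unit0) (hinj : ∀ n < k, Function.Injective (F.toFun n))
    (hsurj : ∀ n, Function.Surjective (F.toFun n)) (hQ : Q.IsTruncated k) :
    OperadIso (P.modTrunc k) Q.toOperad := by
  have ker_eq n : (P.truncIdeal k).carrier n = LinearMap.ker (F.toFun n) := by
    ext θ
    rw [LinearMap.mem_ker, ← Submodule.mem_bot 𝕜, ← hQ n]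
    exact (map_mem_truncSubmodule_iff F h0 hinj θ).symm
  refine ⟨⟨fun n => ((P.truncIdeal k).carrier n).liftQ (F.toFun n) (ker_eq n).le, F.map_one,
    fun σ θ => ?_, fun h i μ ν => ?_⟩, fun n => ⟨?_, ?_⟩⟩
  · induction θ using Submodule.Quotient.induction_on with | _ θ
    exact F.map_act σ θ
  · induction μ using Submodule.Quotient.induction_on with | _ μ
    induction ν using Submodule.Quotient.induction_on with | _ ν
    exact F.map_comp h i μ ν
  · exact LinearMap.ker_eq_bot.mp (Submodule.ker_liftQ_eq_bot _ _ _ (ker_eq n).ge)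
  · exact (hsurj n).forall.mpr fun x => ⟨Submodule.Quotient.mk x, rfl⟩

theorem modTrunc_mk_injective (P : UnitaryOperad 𝕜) {n : ℕ} (hn : n < k) :
    Function.Injective (Submodule.Quotient.mk : P.obj n → (P.modTrunc k).obj n) := by
  have : (P.truncIdeal k).carrier n = ⊥ := (truncSubmodule_eq P k n).trans (truncRec_lt P hn)
  intro x y hxy
  rwa [Submodule.Quotient.eq, this, Submodule.mem_bot, sub_eq_zero] at hxy

end UnitaryOperad

section Derivations

variable {𝕜 : Type u} [CommRing 𝕜]

/-- An operad is connected if the identity spans its unary operations. -/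
def Operad.IsConnected (P : Operad 𝕜) : Prop :=
  ∀ θ : P.obj 1, ∃ c : 𝕜, θ = c • P.one

/-- The derivation multiplying the operations of arity `n` by `(1 - n) c`. -/
def Operad.arityDer (P : Operad 𝕜) (c : 𝕜) : P.der :=
  ⟨fun n => ((1 - (n : 𝕜)) * c) • LinearMap.id, fun n σ θ => by simp, fun m n r h i μ ν => by
    have arity_add : (m : 𝕜) + n = r + 1 := mod_cast congrArg (Nat.cast (R := 𝕜)) h
    simp only [LinearMap.smul_apply, LinearMap.id_apply, map_smul, ← add_smul]
    congr 1
    linear_combination c * arity_add⟩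

theorem Operad.arityDer_apply (P : Operad 𝕜) (c : 𝕜) (n : ℕ) (θ : P.obj n) :
    (P.arityDer c).1 n θ = ((1 - (n : 𝕜)) * c) • θ := rfl

theorem Operad.innerMap_smul_one (P : Operad 𝕜) (c : 𝕜) :
    P.innerMap (c • P.one) = (P.arityDer c).1 := by
  ext n θ
  rw [innerMap_apply, arityDer_apply, map_smul, LinearMap.smul_apply, P.one_comp]
  simp only [map_smul, P.comp_one, Finset.sum_const, Finset.card_univ, Fintype.card_fin]
  rw [← Nat.cast_smul_eq_nsmul 𝕜]
  module

theorem Operad.IsConnected.mem_innerDer_iff {P : Operad 𝕜} (hP : P.IsConnected) (d : P.der) :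
    d ∈ P.innerDer ↔ ∃ c, d = P.arityDer c := by
  simp only [Operad.mem_innerDer_iff, Subtype.ext_iff, ← P.innerMap_smul_one]
  refine ⟨fun ⟨a, ha⟩ => ?_, fun ⟨c, hc⟩ => ⟨_, hc⟩⟩
  obtain ⟨c, rfl⟩ := hP a
  exact ⟨c, ha⟩

theorem Operad.der_one {P : Operad 𝕜} (d : P.der) : d.1 1 P.one = 0 := by
  have := d.2.2 1 1 1 rfl 0 P.one P.one
  rw [P.comp_one, P.comp_one, P.one_comp] at this
  exact left_eq_add.mp this

theorem Operad.IsConnected.der_one_eq_zero {P : Operad 𝕜} (hP : P.IsConnected) (d : P.der) :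
    d.1 1 = 0 := by
  ext θ
  obtain ⟨c, rfl⟩ := hP θ
  rw [map_smul, P.der_one, smul_zero, LinearMap.zero_apply]

namespace UnitaryOperad

variable {P Q : UnitaryOperad 𝕜}

/-- The derivations killing the generator of the nullary operations; for a connected operad they
represent each class of `H¹` exactly once. -/
def normalizedDer (P : UnitaryOperad 𝕜) : Submodule 𝕜 P.der where
  carrier := {d | d.1 0 P.unit0 = 0}
  zero_mem' := rfl
  add_mem' hd he := (congrArg₂ (· + ·) hd he).trans (add_zero 0)
  smul_mem' c _ hd := (congrArg (c • ·) hd).trans (smul_zero c)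

theorem smul_unit0_injective (P : UnitaryOperad 𝕜) :
    Function.Injective fun c : 𝕜 => c • P.unit0 := P.unit0_basis.1

theorem isCompl_innerDer_normalizedDer (hP : P.IsConnected) :
    IsCompl P.innerDer P.normalizedDer := by
  have arityDer_unit0 c : (P.arityDer c).1 0 P.unit0 = c • P.unit0 := by
    rw [Operad.arityDer_apply, Nat.cast_zero, sub_zero, one_mul]
  refine ⟨Submodule.disjoint_def.mpr fun d hd hd0 => ?_, Submodule.codisjoint_iff_exists_add_eq.mpr
    fun d => ?_⟩
  · obtain ⟨c, rfl⟩ := (hP.mem_innerDer_iff d).mp hd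
    have hc : c = 0 := P.smul_unit0_injective <|
      (arityDer_unit0 c).symm.trans (hd0.trans (zero_smul 𝕜 _).symm)
    ext n θ
    rw [Operad.arityDer_apply, hc, mul_zero, zero_smul]
    rfl
  · obtain ⟨c, hc⟩ := P.exists_smul_unit0 (d.1 0 P.unit0)
    refine ⟨P.arityDer c, d - P.arityDer c, (hP.mem_innerDer_iff _).mpr ⟨c, rfl⟩, ?_,
      add_sub_cancel _ _⟩
    exact sub_eq_zero.mpr (hc.trans (arityDer_unit0 c).symm)

/-- For a connected operad, `H¹` is the space of normalized derivations. -/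
noncomputable def h1EquivNormalizedDer (hP : P.IsConnected) : P.H1 ≃ₗ[𝕜] P.normalizedDer :=
  Submodule.quotientEquivOfIsCompl _ _ (isCompl_innerDer_normalizedDer hP)

theorem der_zero_of_mem_normalizedDer {d : P.der} (hd : d ∈ P.normalizedDer) : d.1 0 = 0 := by
  ext θ
  obtain ⟨c, rfl⟩ := P.exists_smul_unit0 θ
  rw [map_smul, show d.1 0 P.unit0 = 0 from hd, smul_zero, LinearMap.zero_apply]

theorem der_comp_unit0 {d : P.der} (hd : d ∈ P.normalizedDer) {m n : ℕ} (h : m + 0 = n + 1)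
    (i : Fin m) (θ : P.obj m) :
    P.comp h i (d.1 m θ) P.unit0 = d.1 n (P.comp h i θ P.unit0) := by
  rw [d.2.2, show d.1 0 P.unit0 = 0 from hd, map_zero, add_zero]

theorem der_eq_zero_of_isTruncated {k : ℕ} (hk : 0 < k) (hP : P.IsTruncated k) {d : P.der}
    (hd : d ∈ P.normalizedDer) (low : ∀ n < k, d.1 n = 0) : d = 0 := by
  refine Subtype.ext (funext fun n => ?_)
  induction n with
  | zero => exact low 0 hk
  | succ n ih =>
    rcases lt_or_ge (n + 1) k with hn | hn
    · exact low _ hn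
    · refine LinearMap.ext fun θ => (isTruncated_iff hk).mp hP n hn _ fun i => ?_
      rw [der_comp_unit0 hd, ih]
      rfl

theorem injective_zero_of_map_unit0 (F : OperadHom P.toOperad Q.toOperad)
    (h0 : F.toFun 0 P.unit0 = Q.unit0) : Function.Injective (F.toFun 0) := by
  refine (injective_iff_map_eq_zero _).mpr fun θ hθ => ?_
  obtain ⟨c, rfl⟩ := P.exists_smul_unit0 θ
  rw [map_smul, h0] at hθ
  rw [Q.smul_unit0_injective (hθ.trans (zero_smul 𝕜 _).symm), zero_smul]

theorem injective_one_of_isConnected (F : OperadHom P.toOperad Q.toOperad)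
    (hP : P.IsConnected) : Function.Injective (F.toFun 1) := by
  refine (injective_iff_map_eq_zero _).mpr fun θ hθ => ?_
  obtain ⟨c, rfl⟩ := hP θ
  have hc : c • Q.unit0 = 0 := by
    rw [← Q.one_comp (n := 0) rfl Q.unit0, ← F.map_one, ← LinearMap.smul_apply, ← map_smul,
      ← map_smul, hθ, map_zero, LinearMap.zero_apply]
  rw [Q.smul_unit0_injective (hc.trans (zero_smul 𝕜 _).symm), zero_smul]

end UnitaryOperad

end Derivations

section Commutative

variable {𝕜 : Type u} [CommRing 𝕜]

theorem OperadHom.comp_mem_range {P Q : Operad 𝕜} (F : OperadHom P Q) {m n r : ℕ}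
    (h : m + n = r + 1) (i : Fin m) {μ : Q.obj m} {ν : Q.obj n}
    (hμ : μ ∈ LinearMap.range (F.toFun m)) (hν : ν ∈ LinearMap.range (F.toFun n)) :
    Q.comp h i μ ν ∈ LinearMap.range (F.toFun r) := by
  obtain ⟨μ, rfl⟩ := hμ
  obtain ⟨ν, rfl⟩ := hν
  exact ⟨P.comp h i μ ν, F.map_comp h i μ ν⟩

theorem OperadHom.iterated_product_mem_range {P Q : Operad 𝕜} (F : OperadHom P Q)
    {q : ∀ n, Q.obj n} (hq : ∀ n, Q.comp (Nat.add_comm 2 n) 0 (q 2) (q n) = q (n + 1))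
    (h0 : q 0 ∈ LinearMap.range (F.toFun 0)) (h2 : q 2 ∈ LinearMap.range (F.toFun 2)) (n : ℕ) :
    q n ∈ LinearMap.range (F.toFun n) := by
  induction n with
  | zero => exact h0
  | succ n ih => exact hq n ▸ F.comp_mem_range _ 0 h2 ih

theorem com_isTruncated {k : ℕ} (hk : 0 < k) : (Com 𝕜).IsTruncated k :=
  (UnitaryOperad.isTruncated_iff hk).mpr fun _ _ θ hθ => (mul_one (M := 𝕜) θ).symm.trans (hθ 0)

theorem com_isConnected : (Com 𝕜).IsConnected :=
  fun θ => ⟨θ, (mul_one (M := 𝕜) θ).symm⟩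

theorem subsingleton_h1_com : Subsingleton (Com 𝕜).H1 := by
  have der_eq_zero (d : (Com 𝕜).normalizedDer) : d.1 = 0 :=
    UnitaryOperad.der_eq_zero_of_isTruncated one_pos (com_isTruncated one_pos) d.2 fun n hn => by
      obtain rfl := Nat.lt_one_iff.mp hn
      exact UnitaryOperad.der_zero_of_mem_normalizedDer d.2
  have : Subsingleton (Com 𝕜).normalizedDer :=
    ⟨fun d e => Subtype.ext ((der_eq_zero d).trans (der_eq_zero e).symm)⟩
  exact (UnitaryOperad.h1EquivNormalizedDer com_isConnected).toEquiv.subsingleton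

theorem UnitaryOperad.modTrunc_iso_com {P : UnitaryOperad 𝕜} (hP : P.IsConnected)
    (F : OperadHom P.toOperad (Com 𝕜).toOperad) (h0 : F.toFun 0 P.unit0 = (Com 𝕜).unit0)
    {μ : P.obj 2} (hμ : F.toFun 2 μ = (1 : 𝕜)) {k : ℕ} (hk : 0 < k) (hk' : k ≤ 2) :
    OperadIso (P.modTrunc k) (Com 𝕜).toOperad := by
  refine modTrunc_iso_of_isTruncated F h0 (fun n hn => ?_) (fun n a => ?_) (com_isTruncated hk)
  · have : n < 2 := by omega
    interval_cases n
    exacts [injective_zero_of_map_unit0 F h0, injective_one_of_isConnected F hP]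
  · obtain ⟨θ, hθ⟩ := F.iterated_product_mem_range (q := fun _ => (1 : 𝕜))
      (fun _ => mul_one (1 : 𝕜)) ⟨_, h0⟩ ⟨μ, hμ⟩ n
    exact ⟨(show 𝕜 from a) • θ, ((F.toFun n).map_smul _ θ).trans
      ((congrArg _ hθ).trans (mul_one (show 𝕜 from a)))⟩

end Commutative

section Collapse

variable {l m n p q r : ℕ}

/-- The map of slots that collapses the block of `n` slots replacing slot `i` to `i`. -/
def collapse (h : m + n = r + 1) (i : Fin m) (x : Fin r) : Fin m :=
  ⟨if x.1 < i.1 then x.1 else if x.1 < i.1 + n then i.1 else x.1 + 1 - n, by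
    split_ifs <;> omega⟩

theorem collapse_val (h : m + n = r + 1) (i : Fin m) (x : Fin r) : (collapse h i x).1 =
    if x.1 < i.1 then x.1 else if x.1 < i.1 + n then i.1 else x.1 + 1 - n := rfl

theorem collapse_outerPos (h : m + n = r + 1) (i a : Fin m) (ha : a ≠ i) :
    collapse h i (outerPos h i a ha) = a := by
  have := Fin.val_ne_of_ne ha
  ext
  rw [collapse_val, outerPos_val, shift]
  split_ifs <;> omega

theorem collapse_innerPos (h : m + n = r + 1) (i : Fin m) (b : Fin n) :
    collapse h i (innerPos h i b) = i := by
  ext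
  rw [collapse_val, innerPos_val]
  split_ifs <;> omega

theorem collapse_comp_permComp (h : m + n = r + 1) (i : Fin m) (φ : Equiv.Perm (Fin m))
    (σ : Equiv.Perm (Fin n)) : collapse h (φ i) ∘ permComp h i φ σ = φ ∘ collapse h i := by
  funext x
  simp only [Function.comp_apply]
  rcases pos_cases h i x with ⟨a, ha, rfl⟩ | ⟨b, rfl⟩
  · rw [permComp_outer, collapse_outerPos, collapse_outerPos]
  · rw [permComp_inner, collapse_innerPos, collapse_innerPos]

theorem collapse_comp_collapse (hp : l + m = p + 1) (hr : p + n = r + 1) (hr' : l + q = r + 1)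
    (i : Fin l) (j : Fin m) :
    collapse hp i ∘ collapse hr ⟨i + j, by omega⟩ = collapse hr' i := by
  funext x
  ext
  simp only [Function.comp_apply, collapse_val]
  split_ifs <;> omega

theorem collapse_comp_collapse_comm (hp : l + m = p + 1) (hr : p + n = r + 1)
    (hq : l + n = q + 1) (hr' : q + m = r + 1) (i j : Fin l) (hij : i < j) :
    collapse hp i ∘ collapse hr ⟨j + m - 1, by omega⟩ =
      collapse hq j ∘ collapse hr' ⟨i, by omega⟩ := by
  have hij' : i.1 < j.1 := hij
  funext x
  ext
  simp only [Function.comp_apply, collapse_val]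
  split_ifs <;> omega

theorem collapse_one (i : Fin m) : collapse (n := 1) rfl i = id := by
  funext x
  ext
  rw [collapse_val]
  split_ifs <;> simp only [id_eq] <;> omega

end Collapse

section AltForm

variable (𝕜 : Type u) [CommRing 𝕜]

/-- Alternating functions of two slots. -/
def altForm (n : ℕ) : Submodule 𝕜 (Fin n → Fin n → 𝕜) where
  carrier := {f | (∀ x, f x x = 0) ∧ ∀ x y, f x y = -f y x}
  zero_mem' := ⟨fun _ => rfl, fun _ _ => neg_zero.symm⟩
  add_mem' {f g} hf hg := ⟨fun x => by simp only [Pi.add_apply, hf.1, hg.1, add_zero],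
    fun x y => by simp only [Pi.add_apply, hf.2 x y, hg.2 x y, neg_add]⟩
  smul_mem' c f hf := ⟨fun x => by simp only [Pi.smul_apply, hf.1, smul_zero],
    fun x y => by simp only [Pi.smul_apply, hf.2 x y, smul_neg]⟩

variable {𝕜} {m n r : ℕ}

theorem altForm_ext {f g : altForm 𝕜 n} (h : ∀ x y, x < y → f.1 x y = g.1 x y) : f = g := by
  refine Subtype.ext (funext fun x => funext fun y => ?_)
  rcases lt_trichotomy x y with hxy | rfl | hxy
  · exact h x y hxy
  · rw [f.2.1, g.2.1]
  · rw [f.2.2, g.2.2, h y x hxy]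

theorem altForm_subsingleton (hn : n ≤ 1) : Subsingleton (altForm 𝕜 n) :=
  ⟨fun _ _ => altForm_ext fun x y hxy => by omega⟩

/-- Pulling back an alternating function along a map of slots. -/
def altPull (p : Fin r → Fin m) : altForm 𝕜 m →ₗ[𝕜] altForm 𝕜 r where
  toFun f := ⟨fun x y => f.1 (p x) (p y), fun _ => f.2.1 _, fun _ _ => f.2.2 _ _⟩
  map_add' _ _ := rfl
  map_smul' _ _ := rfl

theorem altPull_apply (p : Fin r → Fin m) (f : altForm 𝕜 m) (x y : Fin r) :
    (altPull p f).1 x y = f.1 (p x) (p y) := rfl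

theorem altPull_altPull {l : ℕ} (p : Fin r → Fin m) (p' : Fin m → Fin l) (f : altForm 𝕜 l) :
    altPull p (altPull p' f) = altPull (p' ∘ p) f := rfl

/-- Extending an alternating function by zero from the block of `n` slots starting at `i`. -/
def altExtend (i : ℕ) : altForm 𝕜 n →ₗ[𝕜] altForm 𝕜 r where
  toFun g := ⟨fun x y => if h : (i ≤ x.1 ∧ x.1 < i + n) ∧ i ≤ y.1 ∧ y.1 < i + n then
      g.1 ⟨x.1 - i, by omega⟩ ⟨y.1 - i, by omega⟩ else 0, by
    refine ⟨fun x => ?_, fun x y => ?_⟩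
    · dsimp only
      split_ifs
      exacts [g.2.1 _, rfl]
    · simp only [and_comm (a := i ≤ y.1 ∧ _)]
      split_ifs
      exacts [g.2.2 _ _, neg_zero.symm]⟩
  map_add' f g := by
    ext x y
    by_cases h : (i ≤ x.1 ∧ x.1 < i + n) ∧ i ≤ y.1 ∧ y.1 < i + n <;> simp [h]
  map_smul' c f := by
    ext x y
    by_cases h : (i ≤ x.1 ∧ x.1 < i + n) ∧ i ≤ y.1 ∧ y.1 < i + n <;> simp [h]

theorem altExtend_apply (i : ℕ) (g : altForm 𝕜 n) (x y : Fin r) : (altExtend i g).1 x y =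
    if h : (i ≤ x.1 ∧ x.1 < i + n) ∧ i ≤ y.1 ∧ y.1 < i + n then
      g.1 ⟨x.1 - i, by omega⟩ ⟨y.1 - i, by omega⟩ else 0 := rfl

theorem altExtend_zero_self (g : altForm 𝕜 n) : altExtend 0 g = g :=
  altForm_ext fun x y _ => by simp [altExtend_apply]

theorem altExtend_altExtend {q : ℕ} (i : ℕ) {j : ℕ} (hj : j + n ≤ q) (g : altForm 𝕜 n) :
    altExtend (r := r) i (altExtend (r := q) j g) = altExtend (i + j) g := by
  refine altForm_ext fun x y _ => ?_
  simp only [altExtend_apply]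
  split_ifs
  · simp only [Nat.sub_sub]
  all_goals first | rfl | omega

theorem altPull_altExtend {n' r' : ℕ} (p : Fin r' → Fin r) (q : Fin n' → Fin n) {i i' : ℕ}
    (block : ∀ (z : Fin r') (b : Fin n'), z.1 = i' + b.1 → (p z).1 = i + (q b).1)
    (outside : ∀ z, i ≤ (p z).1 → (p z).1 < i + n → i' ≤ z.1 ∧ z.1 < i' + n')
    (g : altForm 𝕜 n) : altPull p (altExtend i g) = altExtend i' (altPull q g) := by
  have mem_block_iff z : (i ≤ (p z).1 ∧ (p z).1 < i + n) ↔ i' ≤ z.1 ∧ z.1 < i' + n' := by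
    refine ⟨fun h => outside z h.1 h.2, fun h => ?_⟩
    have := block z ⟨z.1 - i', by omega⟩ (by simp only; omega)
    omega
  refine altForm_ext fun x y _ => ?_
  simp only [altPull_apply, altExtend_apply, mem_block_iff]
  refine dite_congr rfl (fun h => congrArg₂ g.1 ?_ ?_) fun _ => rfl <;>
    refine Fin.ext (Nat.sub_eq_of_eq_add ?_) <;> rw [Nat.add_comm _ i] <;>
    exact block _ _ (by simp only; omega)

theorem altPull_permComp_altExtend (h : m + n = r + 1) (i : Fin m) (φ : Equiv.Perm (Fin m))
    (σ : Equiv.Perm (Fin n)) (g : altForm 𝕜 n) :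
    altPull (permComp h i φ σ) (altExtend (φ i).1 g) = altExtend i.1 (altPull σ g) := by
  refine altPull_altExtend _ _ (fun z b hz => ?_) (fun z hz hz' => ?_) g
  · obtain rfl : z = innerPos h i b := Fin.ext hz
    rw [permComp_inner, innerPos_val]
  · rcases pos_cases h i z with ⟨a, ha, rfl⟩ | ⟨b, rfl⟩
    · have := Fin.val_ne_of_ne (φ.injective.ne ha)
      rw [permComp_outer, outerPos_val, shift] at hz hz'
      split_ifs at hz hz' <;> omega
    · rw [innerPos_val]
      omega

theorem altPull_collapse_altExtend {l p q : ℕ} (hr : p + n = r + 1) (hq : m + n = q + 1)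
    (i : Fin l) (j : Fin m) (hp : l + m = p + 1) (g : altForm 𝕜 m) :
    altPull (collapse hr ⟨i + j, by omega⟩) (altExtend i.1 g) =
      altExtend i.1 (altPull (collapse hq j) g) := by
  refine altPull_altExtend _ _ (fun z b hz => ?_) (fun z hz hz' => ?_) g
  · simp only [collapse_val]
    split_ifs <;> omega
  · simp only [collapse_val] at hz hz'
    split_ifs at hz hz' <;> omega

theorem altPull_collapse_altExtend_of_lt {q i : ℕ} (h : q + m = r + 1) (j : Fin q)
    (hij : i + n ≤ j) (g : altForm 𝕜 n) :
    altPull (collapse h j) (altExtend i g) = altExtend i g := by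
  refine altPull_altExtend _ id (fun z b hz => ?_) (fun z hz hz' => ?_) g
  · simp only [collapse_val, id_eq]
    split_ifs <;> omega
  · simp only [collapse_val] at hz hz'
    split_ifs at hz hz' <;> omega

theorem altPull_collapse_altExtend_of_gt {q j : ℕ} (h : q + m = r + 1) (i : Fin q)
    (hij : i < j) (g : altForm 𝕜 n) :
    altPull (collapse h i) (altExtend j g) = altExtend (j + m - 1) g := by
  refine altPull_altExtend _ id (fun z b hz => ?_) (fun z hz hz' => ?_) g
  · simp only [collapse_val, id_eq]
    split_ifs <;> omega
  · simp only [collapse_val] at hz hz'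
    split_ifs at hz hz' <;> omega

/-- The partial compositions of `Alt`. -/
def altComp (h : m + n = r + 1) (i : Fin m) :
    𝕜 × altForm 𝕜 m →ₗ[𝕜] 𝕜 × altForm 𝕜 n →ₗ[𝕜] 𝕜 × altForm 𝕜 r :=
  LinearMap.mk₂ 𝕜
    (fun μ ν => (μ.1 * ν.1, ν.1 • altPull (collapse h i) μ.2 + μ.1 • altExtend i ν.2))
    (fun _ _ _ => Prod.ext (add_mul _ _ _)
      (by simp only [Prod.fst_add, Prod.snd_add, map_add]; module))
    (fun _ _ _ => Prod.ext (mul_assoc _ _ _)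
      (by simp only [Prod.smul_fst, Prod.smul_snd, map_smul, smul_eq_mul]; module))
    (fun _ _ _ => Prod.ext (mul_add _ _ _)
      (by simp only [Prod.fst_add, Prod.snd_add, map_add]; module))
    (fun _ _ _ => Prod.ext (mul_left_comm _ _ _)
      (by simp only [Prod.smul_fst, Prod.smul_snd, map_smul, smul_eq_mul]; module))

theorem altComp_apply (h : m + n = r + 1) (i : Fin m) (μ : 𝕜 × altForm 𝕜 m)
    (ν : 𝕜 × altForm 𝕜 n) : altComp h i μ ν =
      (μ.1 * ν.1, ν.1 • altPull (collapse h i) μ.2 + μ.1 • altExtend i ν.2) := rfl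

variable (𝕜)

/-- The operad of alternating functions: an operation is a scalar together with an alternating
function of two slots, composed as in a square-zero extension of `Com`. -/
def Alt : UnitaryOperad 𝕜 where
  obj n := 𝕜 × altForm 𝕜 n
  act σ := LinearMap.prodMap LinearMap.id (altPull σ)
  one := (1, 0)
  comp := altComp
  act_one _ := rfl
  act_mul _ _ _ := rfl
  comp_one i θ := by
    rw [altComp_apply, collapse_one]
    exact Prod.ext (mul_one _) (by rw [map_zero, smul_zero, add_zero, one_smul]; rfl)
  one_comp h θ := by
    rw [altComp_apply]
    refine Prod.ext (one_mul _) ?_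
    rw [map_zero, smul_zero, zero_add, one_smul]
    exact altExtend_zero_self _
  comp_assoc hp hr hq hr' i j a b c := by
    simp only [altComp_apply, map_add, map_smul, altPull_altPull]
    rw [collapse_comp_collapse hp hr hr', altPull_collapse_altExtend hr hq i j hp,
      altExtend_altExtend i.1 (q := _) (by omega)]
    exact Prod.ext (mul_assoc _ _ _) (by simp only; module)
  comp_comm hp hr hq hr' i j hij a b c := by
    simp only [altComp_apply, map_add, map_smul, altPull_altPull]
    rw [collapse_comp_collapse_comm hp hr hq hr' i j hij,
      altPull_collapse_altExtend_of_lt hr _ (by simp only; omega),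
      altPull_collapse_altExtend_of_gt hr' ⟨i, _⟩ (by simpa using hij)]
    exact Prod.ext (mul_right_comm _ _ _) (by simp only; module)
  comp_act h i μ ν σ := by
    have pull := collapse_comp_permComp h i 1 σ
    have extend := altPull_permComp_altExtend h i 1 σ ν.2
    rw [Equiv.Perm.one_apply] at pull extend
    simp only [altComp_apply, LinearMap.prodMap_apply, LinearMap.id_apply, map_add, map_smul,
      altPull_altPull, pull, extend]
    rfl
  act_comp h i μ ν φ := by
    simp only [altComp_apply, LinearMap.prodMap_apply, LinearMap.id_apply, map_add, map_smul,
      altPull_altPull, collapse_comp_permComp, altPull_permComp_altExtend]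
    rfl
  unit0 := (1, 0)
  unit0_basis := by
    have := altForm_subsingleton (𝕜 := 𝕜) zero_le_one
    refine ⟨fun a b h => by simpa using congrArg Prod.fst h, fun θ => ⟨θ.1, ?_⟩⟩
    exact Prod.ext (mul_one _) (Subsingleton.elim _ _)

end AltForm

section Alt

variable {𝕜 : Type u} [CommRing 𝕜] {m n r : ℕ}

variable (𝕜) in
/-- The iterated commutative product of `n` variables in `Alt`. -/
def altProd (n : ℕ) : (Alt 𝕜).obj n := ((1, 0) : 𝕜 × altForm 𝕜 n)

/-- The inclusion of alternating functions into `Alt`, as the square-zero ideal. -/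
def altInr (n : ℕ) : altForm 𝕜 n →ₗ[𝕜] (Alt 𝕜).obj n := LinearMap.inr 𝕜 𝕜 (altForm 𝕜 n)

theorem alt_eq_add {n : ℕ} (θ : (Alt 𝕜).obj n) : θ = θ.1 • altProd 𝕜 n + altInr n θ.2 :=
  Prod.ext ((add_zero _).trans (mul_one _)).symm
    ((congrArg (· + θ.2) (smul_zero _)).trans (zero_add _)).symm

theorem altProd_comp_altProd (h : m + n = r + 1) (i : Fin m) :
    (Alt 𝕜).comp h i (altProd 𝕜 m) (altProd 𝕜 n) = altProd 𝕜 r := by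
  refine (altComp_apply ..).trans (Prod.ext (mul_one _) ?_)
  simp only [altProd, map_zero, smul_zero, add_zero]

theorem altProd_comp_altInr (h : m + n = r + 1) (i : Fin m) (g : altForm 𝕜 n) :
    (Alt 𝕜).comp h i (altProd 𝕜 m) (altInr n g) = altInr r (altExtend i g) := by
  refine (altComp_apply ..).trans (Prod.ext (mul_zero _) ?_)
  change (0 : 𝕜) • altPull _ 0 + (1 : 𝕜) • altExtend i g = altExtend i g
  rw [zero_smul, zero_add, one_smul]

theorem altInr_comp_altProd (h : m + n = r + 1) (i : Fin m) (f : altForm 𝕜 m) :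
    (Alt 𝕜).comp h i (altInr m f) (altProd 𝕜 n) = altInr r (altPull (collapse h i) f) := by
  refine (altComp_apply ..).trans (Prod.ext (zero_mul _) ?_)
  change (1 : 𝕜) • altPull _ f + (0 : 𝕜) • altExtend i 0 = altPull _ f
  rw [zero_smul, add_zero, one_smul]

theorem altInr_comp_altInr (h : m + n = r + 1) (i : Fin m) (f : altForm 𝕜 m)
    (g : altForm 𝕜 n) : (Alt 𝕜).comp h i (altInr m f) (altInr n g) = 0 := by
  refine (altComp_apply ..).trans (Prod.ext (zero_mul _) ?_)
  change (0 : 𝕜) • altPull _ f + (0 : 𝕜) • altExtend i g = 0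
  rw [zero_smul, zero_smul, add_zero]

theorem act_altProd (σ : Equiv.Perm (Fin n)) : (Alt 𝕜).act σ (altProd 𝕜 n) = altProd 𝕜 n :=
  Prod.ext rfl (map_zero (altPull σ))

theorem act_altInr (σ : Equiv.Perm (Fin n)) (f : altForm 𝕜 n) :
    (Alt 𝕜).act σ (altInr n f) = altInr n (altPull σ f) := rfl

theorem altInr_eq_zero {n : ℕ} (hn : n ≤ 1) (f : altForm 𝕜 n) : altInr n f = 0 := by
  have := altForm_subsingleton (𝕜 := 𝕜) hn
  rw [Subsingleton.elim f 0, map_zero]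

theorem alt_comp_unit0 (h : m + 0 = n + 1) (i : Fin m) (θ : (Alt 𝕜).obj m) :
    (Alt 𝕜).comp h i θ (Alt 𝕜).unit0 = (θ.1, altPull (collapse h i) θ.2) := by
  refine (altComp_apply ..).trans (Prod.ext (mul_one _) ?_)
  simp only [Alt, one_smul, map_zero, smul_zero, add_zero]

theorem alt_isTruncated : (Alt 𝕜).IsTruncated 3 := by
  refine (UnitaryOperad.isTruncated_iff three_pos).mpr fun n hn θ hθ => ?_
  simp only [alt_comp_unit0] at hθ
  have fst_eq : θ.1 = (0 : 𝕜) := congrArg (fun ν : 𝕜 × altForm 𝕜 n => ν.1) (hθ 0)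
  refine Prod.ext fst_eq (altForm_ext fun x y _ => ?_)
  obtain ⟨i, hx, hy⟩ := Fin.exists_ne_and_ne_of_two_lt x y (by omega)
  have := congrArg (fun ν : 𝕜 × altForm 𝕜 n => ν.2.1 (outerPos (n := 0) rfl i x hx.symm)
    (outerPos (n := 0) rfl i y hy.symm)) (hθ i)
  dsimp only at this
  rwa [altPull_apply, collapse_outerPos, collapse_outerPos] at this

theorem alt_isConnected : (Alt 𝕜).IsConnected := by
  have := altForm_subsingleton (𝕜 := 𝕜) le_rfl
  exact fun θ => ⟨θ.1, Prod.ext (mul_one _).symm (Subsingleton.elim _ _)⟩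

/-- The alternating function with value `1` at `(x, y)` and `-1` at `(y, x)`. -/
def altBasis (x y : Fin n) : altForm 𝕜 n :=
  ⟨fun u v => (if u = x ∧ v = y then 1 else 0) - if u = y ∧ v = x then 1 else 0,
    fun u => by simp only [and_comm, sub_self],
    fun u v => by simp only [and_comm (a := v = _), neg_sub]⟩

theorem altBasis_apply (x y u v : Fin n) : (altBasis (𝕜 := 𝕜) x y).1 u v =
    (if u = x ∧ v = y then 1 else 0) - if u = y ∧ v = x then 1 else 0 := rfl

theorem altBasis_apply_of_lt {x y u v : Fin n} (hxy : x < y) (huv : u < v) :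
    (altBasis (𝕜 := 𝕜) x y).1 u v = if u = x ∧ v = y then 1 else 0 := by
  rw [altBasis_apply, if_neg (c := u = y ∧ v = x) (by omega), sub_zero]

theorem altForm_eq_sum (f : altForm 𝕜 n) :
    f = ∑ p : Fin n × Fin n with p.1 < p.2, f.1 p.1 p.2 • altBasis p.1 p.2 := by
  refine altForm_ext fun u v huv => ?_
  simp only [AddSubmonoidClass.coe_finsetSum, Finset.sum_apply, SetLike.val_smul, Pi.smul_apply]
  rw [Finset.sum_eq_single (u, v)]
  · rw [altBasis_apply_of_lt huv huv, if_pos ⟨rfl, rfl⟩, smul_eq_mul, mul_one]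
  · intro p hp hne
    rw [altBasis_apply_of_lt (Finset.mem_filter.mp hp).2 huv,
      if_neg fun h => hne (Prod.ext h.1.symm h.2.symm), smul_zero]
  · exact fun h => absurd (Finset.mem_filter_univ (u, v) |>.mpr huv) h

theorem altPull_altBasis (σ : Equiv.Perm (Fin n)) (x y : Fin n) :
    altPull σ (altBasis (𝕜 := 𝕜) (σ x) (σ y)) = altBasis x y :=
  altForm_ext fun u v _ => by simp only [altPull_apply, altBasis_apply, σ.injective.eq_iff]

theorem altExtend_altBasis_zero_one (n : ℕ) :
    altExtend 0 (altBasis (𝕜 := 𝕜) (0 : Fin 2) 1) = altBasis (0 : Fin (n + 2)) 1 := by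
  refine altForm_ext fun u v huv => ?_
  rw [altExtend_apply, altBasis_apply_of_lt Fin.zero_lt_one huv]
  by_cases h : u = 0 ∧ v = 1
  · obtain ⟨rfl, rfl⟩ := h
    simp [altBasis_apply]
  · rw [if_neg h, dif_neg]
    simp only [Fin.ext_iff, Fin.val_zero, Fin.val_one] at h
    omega

theorem altForm_eq_top_of_altPull_mem {S : Submodule 𝕜 (altForm 𝕜 (n + 2))}
    (pull_mem : ∀ (σ : Equiv.Perm (Fin (n + 2))), ∀ f ∈ S, altPull σ f ∈ S)
    (basis_mem : altBasis 0 1 ∈ S) : S = ⊤ := by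
  have pretrans : MulAction.IsMultiplyPretransitive (Equiv.Perm (Fin (n + 2))) (Fin (n + 2)) 2 :=
    Equiv.Perm.isMultiplyPretransitive _ _
  rw [MulAction.is_two_pretransitive_iff] at pretrans
  refine eq_top_iff.mpr fun f _ => altForm_eq_sum f ▸ S.sum_mem fun p hp => S.smul_mem _ ?_
  obtain ⟨σ, hσ⟩ := pretrans (Finset.mem_filter.mp hp).2.ne (Fin.zero_ne_one (n := n))
  rw [← altPull_altBasis σ]
  exact pull_mem σ _ (by rwa [← hσ.1, ← hσ.2] at basis_mem)

variable (𝕜) in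
/-- The antisymmetric bracket of `Alt`. -/
def altBr : (Alt 𝕜).obj 2 := altInr 2 (altBasis 0 1)

theorem act_swap_altBr : (Alt 𝕜).act (Equiv.swap 0 1) (altBr 𝕜) = -altBr 𝕜 := by
  rw [altBr, act_altInr, ← map_neg]
  refine congrArg (altInr 2) (altForm_ext fun x y hxy => ?_)
  obtain ⟨rfl, rfl⟩ : x = 0 ∧ y = 1 := by omega
  exact (altBasis (0 : Fin 2) 1).2.2 1 0

variable (𝕜) in
/-- The coefficient of the bracket in an operation of arity two of `Alt`. -/
def altBrCoeff : (Alt 𝕜).obj 2 →ₗ[𝕜] 𝕜 where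
  toFun θ := θ.2.1 0 1
  map_add' _ _ := rfl
  map_smul' _ _ := rfl

theorem altBrCoeff_altProd : altBrCoeff 𝕜 (altProd 𝕜 2) = 0 := rfl

theorem altBrCoeff_altBr : altBrCoeff 𝕜 (altBr 𝕜) = 1 :=
  (altBasis_apply_of_lt Fin.zero_lt_one Fin.zero_lt_one).trans (if_pos ⟨rfl, rfl⟩)

theorem altProd_altBr_coeff_eq_zero {a b : 𝕜} (h : a • altProd 𝕜 2 + b • altBr 𝕜 = 0) :
    a = 0 ∧ b = 0 := by
  have prod_coeff : a * 1 + b * 0 = 0 := congrArg (fun ν : 𝕜 × altForm 𝕜 2 => ν.1) h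
  have br_coeff := congrArg (altBrCoeff 𝕜) h
  rw [map_add, map_smul, map_smul, altBrCoeff_altProd, altBrCoeff_altBr, map_zero] at br_coeff
  simpa using And.intro prod_coeff br_coeff

theorem alt_two_eq (θ : (Alt 𝕜).obj 2) : θ = θ.1 • altProd 𝕜 2 + altBrCoeff 𝕜 θ • altBr 𝕜 := by
  have bracket_part : θ.2 = altBrCoeff 𝕜 θ • altBasis 0 1 := altForm_ext fun u v huv => by
    obtain ⟨rfl, rfl⟩ : u = 0 ∧ v = 1 := by omega
    exact ((mul_one _).symm.trans (congrArg (_ * ·) altBrCoeff_altBr.symm))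
  rw [altBr, ← map_smul, ← bracket_part]
  exact alt_eq_add θ

theorem alt_surjective {P : Operad 𝕜} (F : OperadHom P (Alt 𝕜).toOperad)
    (h0 : (Alt 𝕜).unit0 ∈ LinearMap.range (F.toFun 0))
    (hmul : altProd 𝕜 2 ∈ LinearMap.range (F.toFun 2))
    (hbr : altBr 𝕜 ∈ LinearMap.range (F.toFun 2)) (n : ℕ) : Function.Surjective (F.toFun n) := by
  have prod_mem : ∀ n, altProd 𝕜 n ∈ LinearMap.range (F.toFun n) :=
    F.iterated_product_mem_range (fun _ => altProd_comp_altProd _ _) h0 hmul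
  have comap_eq_top : (LinearMap.range (F.toFun n)).comap (altInr n) = ⊤ := by
    rcases n with _ | _ | n
    case succ.succ =>
      refine altForm_eq_top_of_altPull_mem (fun σ f ⟨θ, hθ⟩ => ⟨P.act σ θ, ?_⟩) ?_
      · rw [F.map_act, hθ, act_altInr]
      · have := F.comp_mem_range (r := n + 2) (by omega) 0 (prod_mem (n + 1)) hbr
        rwa [altBr, altProd_comp_altInr, Fin.val_zero, altExtend_altBasis_zero_one] at this
    case zero =>
      have : Subsingleton (altForm 𝕜 0) := altForm_subsingleton zero_le_one
      exact eq_top_iff.mpr fun f _ => Subsingleton.elim 0 f ▸ zero_mem _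
    case succ.zero =>
      have : Subsingleton (altForm 𝕜 1) := altForm_subsingleton le_rfl
      exact eq_top_iff.mpr fun f _ => Subsingleton.elim 0 f ▸ zero_mem _
  intro θ
  rw [alt_eq_add θ]
  exact add_mem (Submodule.smul_mem _ _ (prod_mem n))
    (comap_eq_top ▸ Submodule.mem_top : θ.2 ∈ (LinearMap.range (F.toFun n)).comap (altInr n))

theorem UnitaryOperad.modTrunc_iso_alt {P : UnitaryOperad 𝕜} (hP : P.IsConnected)
    (F : OperadHom P.toOperad (Alt 𝕜).toOperad) (h0 : F.toFun 0 P.unit0 = (Alt 𝕜).unit0)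
    {μ τ : P.obj 2} (span : ∀ θ, ∃ a b : 𝕜, θ = a • μ + b • τ) (hμ : F.toFun 2 μ = altProd 𝕜 2)
    (hτ : F.toFun 2 τ = altBr 𝕜) : OperadIso (P.modTrunc 3) (Alt 𝕜).toOperad := by
  refine modTrunc_iso_of_isTruncated F h0 (fun n hn => ?_)
    (alt_surjective F ⟨_, h0⟩ ⟨μ, hμ⟩ ⟨τ, hτ⟩) alt_isTruncated
  interval_cases n
  · exact injective_zero_of_map_unit0 F h0
  · exact injective_one_of_isConnected F hP
  · refine (injective_iff_map_eq_zero _).mpr fun θ hθ => ?_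
    obtain ⟨a, b, rfl⟩ := span θ
    rw [map_add, map_smul, map_smul, hμ, hτ] at hθ
    obtain ⟨rfl, rfl⟩ := altProd_altBr_coeff_eq_zero hθ
    rw [zero_smul, zero_smul, add_zero]

end Alt

section AltDerivations

variable {𝕜 : Type u} [CommRing 𝕜]

variable (𝕜) in
/-- The derivation of `Alt` given by the degree with respect to the square-zero ideal. -/
def altDegDer : (Alt 𝕜).der :=
  ⟨fun n => altInr n ∘ₗ LinearMap.snd 𝕜 𝕜 (altForm 𝕜 n), fun _ _ _ => rfl,
    fun m n r h i μ ν => by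
      have leibniz (μ : 𝕜 × altForm 𝕜 m) (ν : 𝕜 × altForm 𝕜 n) :
          ((0, (altComp h i μ ν).2) : 𝕜 × altForm 𝕜 r) =
            altComp h i (0, μ.2) ν + altComp h i μ (0, ν.2) := by
        simp [altComp_apply]
      exact leibniz μ ν⟩

theorem altDegDer_mem_normalizedDer : altDegDer 𝕜 ∈ (Alt 𝕜).normalizedDer :=
  map_zero (altInr 0)

variable {d : (Alt 𝕜).der}

theorem alt_der_two_fst_eq_zero (hd : d ∈ (Alt 𝕜).normalizedDer) (θ : (Alt 𝕜).obj 2) :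
    (d.1 2 θ).1 = 0 := by
  have := UnitaryOperad.der_comp_unit0 hd (n := 1) rfl 0 θ
  rw [alt_isConnected.der_one_eq_zero, alt_comp_unit0] at this
  exact congrArg (fun ν : 𝕜 × altForm 𝕜 1 => ν.1) this

theorem alt_der_two_eq_smul_altBr (hd : d ∈ (Alt 𝕜).normalizedDer) (θ : (Alt 𝕜).obj 2) :
    d.1 2 θ = altBrCoeff 𝕜 (d.1 2 θ) • altBr 𝕜 := by
  conv_lhs => rw [alt_two_eq (d.1 2 θ), alt_der_two_fst_eq_zero hd, zero_smul, zero_add]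

theorem altBrCoeff_act_swap (θ : (Alt 𝕜).obj 2) :
    altBrCoeff 𝕜 ((Alt 𝕜).act (Equiv.swap 0 1) θ) = -altBrCoeff 𝕜 θ :=
  θ.2.2.2 1 0

theorem alt_der_altProd_two (h2 : IsUnit (2 : 𝕜)) (hd : d ∈ (Alt 𝕜).normalizedDer) :
    d.1 2 (altProd 𝕜 2) = 0 := by
  have antisymm := altBrCoeff_act_swap (d.1 2 (altProd 𝕜 2))
  rw [← d.2.1, act_altProd, eq_neg_iff_add_eq_zero, ← two_mul, h2.mul_right_eq_zero] at antisymm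
  rw [alt_der_two_eq_smul_altBr hd, antisymm, zero_smul]

theorem alt_der_eq_zero_of_altBr (h2 : IsUnit (2 : 𝕜)) (hd : d ∈ (Alt 𝕜).normalizedDer)
    (hbr : altBrCoeff 𝕜 (d.1 2 (altBr 𝕜)) = 0) : d = 0 := by
  refine UnitaryOperad.der_eq_zero_of_isTruncated three_pos alt_isTruncated hd fun n hn => ?_
  interval_cases n
  · exact UnitaryOperad.der_zero_of_mem_normalizedDer hd
  · exact alt_isConnected.der_one_eq_zero d
  · ext θ
    rw [alt_two_eq θ, map_add, map_smul, map_smul, alt_der_altProd_two h2 hd,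
      alt_der_two_eq_smul_altBr hd (altBr 𝕜), hbr, zero_smul, smul_zero, smul_zero, add_zero,
      LinearMap.zero_apply]

theorem nonempty_h1_alt_equiv (h2 : IsUnit (2 : 𝕜)) : Nonempty ((Alt 𝕜).H1 ≃ₗ[𝕜] 𝕜) := by
  let brCoeff : (Alt 𝕜).normalizedDer →ₗ[𝕜] 𝕜 :=
    { toFun := fun d => altBrCoeff 𝕜 (d.1.1 2 (altBr 𝕜))
      map_add' := fun _ _ => rfl
      map_smul' := fun _ _ => rfl }
  have injective : Function.Injective brCoeff := (injective_iff_map_eq_zero _).mpr fun d hd =>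
    Subtype.ext (alt_der_eq_zero_of_altBr h2 d.2 hd)
  have surjective : Function.Surjective brCoeff := fun c =>
    ⟨c • ⟨altDegDer 𝕜, altDegDer_mem_normalizedDer⟩, by
      rw [map_smul, smul_eq_mul]
      exact (congrArg _ altBrCoeff_altBr).trans (mul_one c)⟩
  exact ⟨(UnitaryOperad.h1EquivNormalizedDer alt_isConnected).trans
    (LinearEquiv.ofBijective brCoeff ⟨injective, surjective⟩)⟩

end AltDerivations

section Associative

variable {𝕜 : Type u} [CommRing 𝕜]

theorem Operad.act_comp_act (P : Operad 𝕜) {m n r : ℕ} (h : m + n = r + 1) (i : Fin m)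
    (φ : Equiv.Perm (Fin m)) (σ : Equiv.Perm (Fin n)) (μ : P.obj m) (ν : P.obj n) :
    P.comp h i (P.act φ μ) (P.act σ ν) = P.act (permComp h i φ σ) (P.comp h (φ i) μ ν) := by
  rw [P.act_comp, P.comp_act, ← P.act_mul, ← permComp_mul, one_mul, mul_one]

variable (𝕜) in
/-- A permutation as an operation of `As`. -/
noncomputable def asPerm {n : ℕ} (σ : Equiv.Perm (Fin n)) : (As 𝕜).obj n :=
  Finsupp.single σ (1 : 𝕜)

theorem as_comp_asPerm {m n r : ℕ} (h : m + n = r + 1) (i : Fin m) (φ : Equiv.Perm (Fin m))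
    (σ : Equiv.Perm (Fin n)) :
    (As 𝕜).comp h i (asPerm 𝕜 φ) (asPerm 𝕜 σ) = asPerm 𝕜 (permComp h i φ σ) := by
  have comp_single : (Finsupp.linearCombination 𝕜 fun φ => Finsupp.lmapDomain 𝕜 𝕜 (permComp h i φ))
      (Finsupp.single φ (1 : 𝕜)) (Finsupp.single σ (1 : 𝕜)) =
      Finsupp.single (permComp h i φ σ) (1 : 𝕜) := by
    simp
  exact comp_single

theorem as_act_asPerm {n : ℕ} (φ σ : Equiv.Perm (Fin n)) :
    (As 𝕜).act σ (asPerm 𝕜 φ) = asPerm 𝕜 (φ * σ) :=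
  Finsupp.mapDomain_single

theorem as_induction {n : ℕ} {p : (As 𝕜).obj n → Prop} (θ : (As 𝕜).obj n) (zero : p 0)
    (add : ∀ θ θ', p θ → p θ' → p (θ + θ')) (smul_asPerm : ∀ (c : 𝕜) σ, p (c • asPerm 𝕜 σ)) :
    p θ :=
  Finsupp.induction_linear θ zero add fun σ c =>
    (Finsupp.smul_single_one σ c) ▸ smul_asPerm c σ

/-- The linear map out of `As(n)` with prescribed values on permutations. -/
noncomputable def asLinearLift {n : ℕ} {M : Type*} [AddCommGroup M] [Module 𝕜 M]
    (g : Equiv.Perm (Fin n) → M) : (As 𝕜).obj n →ₗ[𝕜] M :=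
  Finsupp.linearCombination 𝕜 g

theorem asLinearLift_asPerm {n : ℕ} {M : Type*} [AddCommGroup M] [Module 𝕜 M]
    (g : Equiv.Perm (Fin n) → M) (σ : Equiv.Perm (Fin n)) :
    asLinearLift g (asPerm 𝕜 σ) = g σ :=
  (Finsupp.linearCombination_single 𝕜 _ _).trans (one_smul _ _)

/-- The morphism out of `As` determined by a family of operations that represents the iterated
product of each arity. -/
noncomputable def asLift (Q : Operad 𝕜) (q : ∀ n, Q.obj n) (hone : q 1 = Q.one)
    (hcomp : ∀ {m n r : ℕ} (h : m + n = r + 1) (i : Fin m), Q.comp h i (q m) (q n) = q r) :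
    OperadHom (As 𝕜).toOperad Q where
  toFun n := asLinearLift fun σ => Q.act σ (q n)
  map_one := (asLinearLift_asPerm _ 1).trans ((Q.act_one _).trans hone)
  map_act σ θ := by
    induction θ using as_induction with
    | zero => simp only [map_zero]
    | add θ θ' hθ hθ' => simp only [map_add, hθ, hθ']
    | smul_asPerm c φ =>
      simp only [map_smul, as_act_asPerm, asLinearLift_asPerm, Q.act_mul]
  map_comp {m n r} h i μ ν := by
    induction μ using as_induction with
    | zero => simp only [map_zero, LinearMap.zero_apply]
    | add θ θ' hθ hθ' => simp only [map_add, LinearMap.add_apply, hθ, hθ']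
    | smul_asPerm s φ =>
      induction ν using as_induction with
      | zero => simp only [map_zero]
      | add θ θ' hθ hθ' => simp only [map_add, hθ, hθ']
      | smul_asPerm t σ =>
        simp only [map_smul, LinearMap.smul_apply, as_comp_asPerm, asLinearLift_asPerm,
          Q.act_comp_act, hcomp]

theorem asLift_asPerm (Q : Operad 𝕜) (q : ∀ n, Q.obj n) (hone) (hcomp) {n : ℕ}
    (σ : Equiv.Perm (Fin n)) : (asLift Q q hone hcomp).toFun n (asPerm 𝕜 σ) = Q.act σ (q n) :=
  asLinearLift_asPerm _ σ

theorem as_isConnected : (As 𝕜).IsConnected := fun θ => by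
  induction θ using as_induction with
  | zero => exact ⟨0, (zero_smul _ _).symm⟩
  | add θ θ' hθ hθ' =>
    obtain ⟨⟨c, rfl⟩, c', rfl⟩ := And.intro hθ hθ'
    exact ⟨c + c', (add_smul _ _ _).symm⟩
  | smul_asPerm c σ => exact ⟨c, Subsingleton.elim σ 1 ▸ rfl⟩

theorem perm_two_eq_one_or_swap : ∀ σ : Equiv.Perm (Fin 2), σ = 1 ∨ σ = Equiv.swap 0 1 := by decide

theorem as_two_eq (θ : (As 𝕜).obj 2) :
    ∃ a b : 𝕜, θ = a • asPerm 𝕜 1 + b • asPerm 𝕜 (Equiv.swap 0 1) := by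
  induction θ using as_induction with
  | zero => exact ⟨0, 0, by simp only [zero_smul, add_zero]⟩
  | add θ θ' hθ hθ' =>
    obtain ⟨⟨a, b, rfl⟩, a', b', rfl⟩ := And.intro hθ hθ'
    exact ⟨a + a', b + b', by module⟩
  | smul_asPerm c σ =>
    rcases perm_two_eq_one_or_swap σ with rfl | rfl
    exacts [⟨c, 0, by rw [zero_smul, add_zero]⟩, ⟨0, c, by rw [zero_smul, zero_add]⟩]

variable (𝕜) in
/-- The augmentation of `As`: the morphism sending every permutation to `1`. -/
noncomputable def asToCom : OperadHom (As 𝕜).toOperad (Com 𝕜).toOperad :=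
  asLift _ (fun _ => (1 : 𝕜)) rfl fun _ _ => mul_one (1 : 𝕜)

theorem asToCom_asPerm {n : ℕ} (σ : Equiv.Perm (Fin n)) :
    (asToCom 𝕜).toFun n (asPerm 𝕜 σ) = (1 : 𝕜) :=
  asLift_asPerm ..

theorem as_modTrunc_iso_com {k : ℕ} (hk : 0 < k) (hk' : k ≤ 2) :
    OperadIso ((As 𝕜).modTrunc k) (Com 𝕜).toOperad :=
  UnitaryOperad.modTrunc_iso_com as_isConnected (asToCom 𝕜) (asToCom_asPerm _)
    (asToCom_asPerm 1) hk hk'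

/-- The alternating function with value `1` on the increasing pairs of slots. -/
def orderForm (n : ℕ) : altForm 𝕜 n :=
  ⟨fun x y => (if x < y then 1 else 0) - if y < x then 1 else 0, fun _ => sub_self _,
    fun _ _ => (neg_sub _ _).symm⟩

theorem orderForm_apply {n : ℕ} (x y : Fin n) : (orderForm (𝕜 := 𝕜) n).1 x y =
    (if x < y then 1 else 0) - if y < x then 1 else 0 := rfl

theorem orderForm_apply_of_lt {n : ℕ} {x y : Fin n} (hxy : x < y) :
    (orderForm (𝕜 := 𝕜) n).1 x y = 1 := by
  rw [orderForm_apply, if_pos hxy, if_neg hxy.not_gt, sub_zero]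

theorem altPull_collapse_orderForm_add_altExtend_orderForm {m n r : ℕ} (h : m + n = r + 1)
    (i : Fin m) : altPull (collapse h i) (orderForm m) + altExtend i (orderForm n) =
      orderForm (𝕜 := 𝕜) r := by
  refine altForm_ext fun x y hxy => ?_
  rw [orderForm_apply_of_lt hxy]
  change (orderForm m).1 (collapse h i x) (collapse h i y) +
    (altExtend (𝕜 := 𝕜) i (orderForm n)).1 x y = 1
  rw [altExtend_apply]
  have hxy : x.1 < y.1 := hxy
  split_ifs with block
  · have : collapse h i x = collapse h i y := by
      ext
      simp only [collapse_val]
      split_ifs <;> omega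
    rw [this, (orderForm m).2.1, orderForm_apply_of_lt (by simp only [Fin.lt_def]; omega),
      zero_add]
  · rw [orderForm_apply_of_lt, add_zero]
    simp only [Fin.lt_def, collapse_val]
    split_ifs <;> omega

theorem altInr_orderForm_two : altInr 2 (orderForm 2) = altBr 𝕜 :=
  congrArg (altInr 2) <| altForm_ext fun x y hxy => by
    rw [orderForm_apply_of_lt hxy, altBasis_apply_of_lt Fin.zero_lt_one hxy,
      if_pos (show x = 0 ∧ y = 1 by omega)]

/-- The morphism sending the associative product to the commutative one plus `c` times the
bracket. -/
noncomputable def asToAlt (c : 𝕜) : OperadHom (As 𝕜).toOperad (Alt 𝕜).toOperad :=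
  asLift _ (fun n => altProd 𝕜 n + c • altInr n (orderForm n))
    (by rw [altInr_eq_zero le_rfl, smul_zero, add_zero]; rfl)
    (fun h i => by
      simp only [map_add, map_smul, LinearMap.add_apply, LinearMap.smul_apply,
        altProd_comp_altProd, altProd_comp_altInr, altInr_comp_altProd, altInr_comp_altInr,
        ← altPull_collapse_orderForm_add_altExtend_orderForm h i]
      module)

theorem asToAlt_unit0 (c : 𝕜) : (asToAlt c).toFun 0 (As 𝕜).unit0 = (Alt 𝕜).unit0 :=
  (asLift_asPerm (σ := 1) ..).trans <| by
    rw [altInr_eq_zero zero_le_one, smul_zero, add_zero, act_altProd]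
    rfl

theorem asToAlt_asPerm_one (c : 𝕜) :
    (asToAlt c).toFun 2 (asPerm 𝕜 1) = altProd 𝕜 2 + c • altBr 𝕜 := by
  rw [asToAlt, asLift_asPerm, Operad.act_one, altInr_orderForm_two]

theorem asToAlt_asPerm_swap (c : 𝕜) :
    (asToAlt c).toFun 2 (asPerm 𝕜 (Equiv.swap 0 1)) = altProd 𝕜 2 - c • altBr 𝕜 := by
  rw [asToAlt, asLift_asPerm, altInr_orderForm_two, map_add, map_smul, act_altProd,
    act_swap_altBr, smul_neg, ← sub_eq_add_neg]

theorem as_modTrunc_three_iso_alt (h2 : IsUnit (2 : 𝕜)) :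
    OperadIso ((As 𝕜).modTrunc 3) (Alt 𝕜).toOperad := by
  obtain ⟨c, hc⟩ := h2.exists_right_inv
  refine UnitaryOperad.modTrunc_iso_alt as_isConnected (asToAlt c) (asToAlt_unit0 c)
    (μ := c • (asPerm 𝕜 1 + asPerm 𝕜 (Equiv.swap 0 1)))
    (τ := asPerm 𝕜 1 - asPerm 𝕜 (Equiv.swap 0 1)) (fun θ => ?_) ?_ ?_
  · obtain ⟨a, b, rfl⟩ := as_two_eq θ
    refine ⟨a + b, c * (a - b), ?_⟩
    match_scalars
    · linear_combination -a * hc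
    · linear_combination -b * hc
  · rw [map_smul, map_add, asToAlt_asPerm_one, asToAlt_asPerm_swap]
    match_scalars
    · linear_combination hc
    · ring
  · rw [map_sub, asToAlt_asPerm_one, asToAlt_asPerm_swap]
    match_scalars
    · ring
    · linear_combination hc

end Associative

section LowHull

variable {𝕜 : Type u} [CommRing 𝕜]

theorem Operad.comp_nullary_cases (P : Operad 𝕜) {m n r : ℕ} (h : m + 1 + (n + 1) = r + 1 + 1)
    (i : Fin (m + 1)) (μ : P.obj (m + 1)) (ν : P.obj (n + 1)) (e : P.obj 0) (x : Fin (r + 1)) :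
    (∃ a j, P.comp (n := 0) rfl x (P.comp h i μ ν) e =
      P.comp (m := m) (by omega) j (P.comp (n := 0) rfl a μ e) ν) ∨
    ∃ b, P.comp (n := 0) rfl x (P.comp h i μ ν) e =
      P.comp (n := n) (by omega) i μ (P.comp (n := 0) rfl b ν e) := by
  rcases pos_cases h i x with ⟨a, ha, rfl⟩ | ⟨b, rfl⟩
  · refine .inl ⟨a, ?_⟩
    rcases lt_or_gt_of_ne ha with hlt | hlt
    · have pos : outerPos h i a ha = ⟨a, by omega⟩ :=
        Fin.ext ((outerPos_val ..).trans (if_pos hlt))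
      exact ⟨_, pos ▸ (P.comp_comm (m := 0) (n := n + 1) rfl (by omega) h rfl a i hlt μ e ν).symm⟩
    · have pos : outerPos h i a ha = ⟨a + (n + 1) - 1, by omega⟩ :=
        Fin.ext ((outerPos_val ..).trans (if_neg (not_lt.mpr hlt.le)))
      exact ⟨_, pos ▸ P.comp_comm (m := n + 1) (n := 0) h rfl rfl (by omega) i a hlt μ ν e⟩
  · exact .inr ⟨b, P.comp_assoc (m := n + 1) (n := 0) h rfl rfl (by omega) i b μ ν e⟩

/-- The operations whose substitutions of the nullary operation `e` down to arity two lie in `A`;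
in arities zero and one, the multiples of `e` and of the identity. If `A` is closed under the
symmetric group and under these substitutions, this is a suboperad, so a presented operad is
determined in low arity by its generators. -/
def lowHull (P : Operad 𝕜) (e : P.obj 0) (A : Submodule 𝕜 (P.obj 2)) :
    ∀ n, Submodule 𝕜 (P.obj n)
  | 0 => Submodule.span 𝕜 {e}
  | 1 => Submodule.span 𝕜 {P.one}
  | 2 => A
  | n + 3 => ⨅ i : Fin (n + 3), (lowHull P e A (n + 2)).comap
      ((P.comp (m := n + 3) (n := 0) (r := n + 2) rfl i).flip e)

variable {P : Operad 𝕜} {e : P.obj 0} {A : Submodule 𝕜 (P.obj 2)}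

theorem mem_lowHull {n : ℕ} (hn : 2 ≤ n) (θ : P.obj (n + 1)) :
    θ ∈ lowHull P e A (n + 1) ↔ ∀ i, P.comp (n := 0) rfl i θ e ∈ lowHull P e A n := by
  obtain ⟨n, rfl⟩ := Nat.exists_eq_add_of_le' hn
  simp only [lowHull, Submodule.mem_iInf, Submodule.mem_comap, LinearMap.flip_apply]

theorem lowHull_act (act_mem : ∀ θ ∈ A, ∀ σ, P.act σ θ ∈ A) {n : ℕ} (σ : Equiv.Perm (Fin n))
    {θ : P.obj n} (hθ : θ ∈ lowHull P e A n) : P.act σ θ ∈ lowHull P e A n := by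
  induction n with
  | zero => rwa [Subsingleton.elim σ 1, P.act_one]
  | succ n ih =>
    rcases le_or_gt 2 n with hn | hn
    · rw [mem_lowHull hn] at hθ ⊢
      intro i
      rw [P.act_comp]
      exact ih _ (hθ _)
    · interval_cases n
      · rwa [Subsingleton.elim (α := Equiv.Perm (Fin 1)) σ 1, P.act_one]
      · exact act_mem _ hθ _

theorem one_comp_mem_lowHull {n r : ℕ} (h : 1 + n = r + 1) (i : Fin 1) {μ : P.obj 1}
    {ν : P.obj n} (hμ : μ ∈ lowHull P e A 1) (hν : ν ∈ lowHull P e A n) :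
    P.comp h i μ ν ∈ lowHull P e A r := by
  obtain rfl : n = r := by omega
  obtain rfl : i = 0 := Subsingleton.elim _ _
  obtain ⟨c, rfl⟩ := Submodule.mem_span_singleton.mp hμ
  rw [map_smul, LinearMap.smul_apply, P.one_comp]
  exact Submodule.smul_mem _ _ hν

theorem comp_one_mem_lowHull {m r : ℕ} (h : m + 1 = r + 1) (i : Fin m) {μ : P.obj m}
    {ν : P.obj 1} (hμ : μ ∈ lowHull P e A m) (hν : ν ∈ lowHull P e A 1) :
    P.comp h i μ ν ∈ lowHull P e A r := by
  obtain rfl : m = r := by omega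
  obtain ⟨c, rfl⟩ := Submodule.mem_span_singleton.mp hν
  rw [map_smul, P.comp_one]
  exact Submodule.smul_mem _ _ hμ

theorem comp_zero_mem_lowHull
    (comp_mem : ∀ θ ∈ A, ∀ i, P.comp (n := 0) (r := 1) rfl i θ e ∈ Submodule.span 𝕜 {P.one})
    {m r : ℕ} (h : m + 0 = r + 1) (i : Fin m) {μ : P.obj m}
    {ν : P.obj 0} (hμ : μ ∈ lowHull P e A m) (hν : ν ∈ lowHull P e A 0) :
    P.comp h i μ ν ∈ lowHull P e A r := by
  obtain rfl : m = r + 1 := h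
  rcases le_or_gt 2 r with hr | hr
  · obtain ⟨c, rfl⟩ := Submodule.mem_span_singleton.mp hν
    rw [map_smul]
    exact Submodule.smul_mem _ _ ((mem_lowHull hr μ).mp hμ i)
  · interval_cases r
    · exact one_comp_mem_lowHull (n := 0) rfl i hμ hν
    · obtain ⟨c, rfl⟩ := Submodule.mem_span_singleton.mp hν
      rw [map_smul]
      exact Submodule.smul_mem _ _ (comp_mem μ hμ i)

theorem lowHull_comp
    (comp_mem : ∀ θ ∈ A, ∀ i, P.comp (n := 0) (r := 1) rfl i θ e ∈ Submodule.span 𝕜 {P.one})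
    {m n r : ℕ} (h : m + n = r + 1) (i : Fin m) {μ : P.obj m} {ν : P.obj n}
    (hμ : μ ∈ lowHull P e A m) (hν : ν ∈ lowHull P e A n) :
    P.comp h i μ ν ∈ lowHull P e A r := by
  induction r generalizing m n with
  | zero =>
    obtain rfl : n = 0 := by have := i.pos; omega
    exact comp_zero_mem_lowHull comp_mem h i hμ hν
  | succ r ih =>
    obtain ⟨m, rfl⟩ := Nat.exists_eq_succ_of_ne_zero i.pos.ne'
    rcases n with _ | n
    · exact comp_zero_mem_lowHull comp_mem h i hμ hν
    rcases le_or_gt 2 r with hr | hr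
    · refine (mem_lowHull hr _).mpr fun x => ?_
      have unit_mem : e ∈ lowHull P e A 0 := Submodule.mem_span_singleton_self e
      rcases P.comp_nullary_cases h i μ ν e x with ⟨a, j, hx⟩ | ⟨b, hx⟩ <;> rw [hx]
      · exact ih _ _ (comp_zero_mem_lowHull comp_mem rfl a hμ unit_mem) hν
      · exact ih _ _ hμ (comp_zero_mem_lowHull comp_mem rfl b hν unit_mem)
    · obtain rfl | rfl : m = 0 ∨ n = 0 := by omega
      exacts [one_comp_mem_lowHull h i hμ hν, comp_one_mem_lowHull h i hμ hν]

end LowHull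

section Poisson

variable (𝕜 : Type u) [CommRing 𝕜]

/-- The product of `Pois`. -/
def poisMul : (Pois 𝕜).obj 2 := presentedMk (PoisRel 𝕜) (mulT 𝕜)

/-- The bracket of `Pois`. -/
def poisBr : (Pois 𝕜).obj 2 := presentedMk (PoisRel 𝕜) (brT 𝕜)

theorem poisMul_comp_unit0 (i : Fin 2) :
    (Pois 𝕜).comp (n := 0) (r := 1) rfl i (poisMul 𝕜) (Pois 𝕜).unit0 = (Pois 𝕜).one :=
  Quotient.sound (.of (.mul_unit i))

theorem poisBr_comp_unit0 (i : Fin 2) :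
    (Pois 𝕜).comp (n := 0) (r := 1) rfl i (poisBr 𝕜) (Pois 𝕜).unit0 = 0 :=
  Quotient.sound (.of (.br_unit i))

theorem act_swap_poisMul : (Pois 𝕜).act (Equiv.swap 0 1) (poisMul 𝕜) = poisMul 𝕜 :=
  Quotient.sound (.of .mul_comm)

theorem act_swap_poisBr : (Pois 𝕜).act (Equiv.swap 0 1) (poisBr 𝕜) = (-1 : 𝕜) • poisBr 𝕜 :=
  Quotient.sound (.of .br_skew)

theorem poisMul_assoc :
    (Pois 𝕜).comp (n := 2) (r := 3) rfl 0 (poisMul 𝕜) (poisMul 𝕜) =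
      (Pois 𝕜).comp (n := 2) rfl 1 (poisMul 𝕜) (poisMul 𝕜) :=
  Quotient.sound (.of .mul_assoc)

variable {𝕜}

theorem act_mem_span_poisMul_poisBr {θ : (Pois 𝕜).obj 2}
    (hθ : θ ∈ Submodule.span 𝕜 {poisMul 𝕜, poisBr 𝕜}) (σ : Equiv.Perm (Fin 2)) :
    (Pois 𝕜).act σ θ ∈ Submodule.span 𝕜 {poisMul 𝕜, poisBr 𝕜} := by
  rcases perm_two_eq_one_or_swap σ with rfl | rfl
  · rwa [(Pois 𝕜).act_one]
  · obtain ⟨a, b, rfl⟩ := Submodule.mem_span_pair.mp hθ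
    rw [map_add, map_smul, map_smul, act_swap_poisMul, act_swap_poisBr, smul_smul]
    exact Submodule.mem_span_pair.mpr ⟨a, b * -1, rfl⟩

theorem comp_unit0_mem_span_one {θ : (Pois 𝕜).obj 2}
    (hθ : θ ∈ Submodule.span 𝕜 {poisMul 𝕜, poisBr 𝕜}) (i : Fin 2) :
    (Pois 𝕜).comp (n := 0) (r := 1) rfl i θ (Pois 𝕜).unit0 ∈ Submodule.span 𝕜 {(Pois 𝕜).one} := by
  obtain ⟨a, b, rfl⟩ := Submodule.mem_span_pair.mp hθ
  rw [map_add, map_smul, map_smul, LinearMap.add_apply, LinearMap.smul_apply,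
    LinearMap.smul_apply, poisMul_comp_unit0, poisBr_comp_unit0, smul_zero, add_zero]
  exact Submodule.smul_mem _ _ (Submodule.mem_span_singleton_self _)

theorem pois_mem_lowHull {n : ℕ} (θ : (Pois 𝕜).obj n) :
    θ ∈ lowHull (Pois 𝕜).toOperad (Pois 𝕜).unit0
      (Submodule.span 𝕜 {poisMul 𝕜, poisBr 𝕜}) n := by
  suffices ∀ {n} (t : OpTerm 𝕜 PoisGen n), presentedMk (PoisRel 𝕜) t ∈
      lowHull (Pois 𝕜).toOperad (Pois 𝕜).unit0 (Submodule.span 𝕜 {poisMul 𝕜, poisBr 𝕜}) n from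
    θ.ind this
  intro n t
  induction t with
  | gen g =>
    cases g with
    | unit => exact Submodule.mem_span_singleton_self (Pois 𝕜).unit0
    | mul => exact Submodule.subset_span (Set.mem_insert (poisMul 𝕜) _)
    | br => exact Submodule.subset_span (Set.mem_insert_of_mem _ (Set.mem_singleton (poisBr 𝕜)))
  | one => exact Submodule.mem_span_singleton_self (Pois 𝕜).one
  | zero n => exact zero_mem _
  | add a b iha ihb => exact add_mem iha ihb
  | smul c a ih => exact Submodule.smul_mem _ c ih
  | act σ a ih => exact lowHull_act (fun _ hθ σ => act_mem_span_poisMul_poisBr hθ σ) σ ih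
  | comp h i a b iha ihb =>
    exact lowHull_comp (fun _ hθ i => comp_unit0_mem_span_one hθ i) h i iha ihb

theorem pois_isConnected : (Pois 𝕜).IsConnected := fun θ => by
  obtain ⟨c, hc⟩ := Submodule.mem_span_singleton.mp (pois_mem_lowHull θ)
  exact ⟨c, hc.symm⟩

theorem pois_two_eq (θ : (Pois 𝕜).obj 2) : ∃ a b : 𝕜, θ = a • poisMul 𝕜 + b • poisBr 𝕜 := by
  obtain ⟨a, b, hab⟩ := Submodule.mem_span_pair.mp (pois_mem_lowHull θ)
  exact ⟨a, b, hab.symm⟩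

theorem pois_modTrunc_iso_com {k : ℕ} (hk : 0 < k) (hk' : k ≤ 2) :
    OperadIso ((Pois 𝕜).modTrunc k) (Com 𝕜).toOperad :=
  UnitaryOperad.modTrunc_iso_com pois_isConnected poisToCom rfl (μ := poisMul 𝕜) rfl hk hk'

theorem altPull_collapse_altBasis_leibniz :
    altPull (collapse (n := 2) (r := 3) rfl 0) (altBasis (𝕜 := 𝕜) (0 : Fin 2) 1) =
      altExtend 1 (altBasis (0 : Fin 2) 1) +
        altPull (Equiv.swap 0 1) (altExtend 1 (altBasis (0 : Fin 2) 1)) := by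
  have swap_two : Equiv.swap (0 : Fin 3) 1 2 = 2 := by decide
  refine altForm_ext fun x y _ => ?_
  let basis := altBasis (𝕜 := 𝕜) (0 : Fin 2) 1
  let extended : altForm 𝕜 3 := altExtend 1 basis
  change basis.1 (collapse (n := 2) rfl 0 x) (collapse (n := 2) rfl 0 y) =
    extended.1 x y + extended.1 (Equiv.swap 0 1 x) (Equiv.swap 0 1 y)
  fin_cases x <;> fin_cases y <;>
    simp [basis, extended, altExtend_apply, altBasis_apply, collapse, swap_two]

variable (𝕜) in
/-- The images in `Alt` of the generators of `Pois`. -/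
def poisGenToAlt : ∀ n, PoisGen n → (Alt 𝕜).obj n
  | _, .unit => (Alt 𝕜).unit0
  | _, .mul => altProd 𝕜 2
  | _, .br => altBr 𝕜

theorem eval_poisGenToAlt_eq {n : ℕ} {a b : OpTerm 𝕜 PoisGen n} (h : PoisRel 𝕜 n a b) :
    a.eval (Alt 𝕜).toOperad (poisGenToAlt 𝕜) = b.eval (Alt 𝕜).toOperad (poisGenToAlt 𝕜) := by
  let comp := (Alt 𝕜).comp (m := 2) (n := 2) (r := 3) rfl
  cases h with
  | mul_unit i => exact altProd_comp_altProd (n := 0) rfl i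
  | br_unit i =>
    exact (altInr_comp_altProd (n := 0) (r := 1) rfl i _).trans (altInr_eq_zero le_rfl _)
  | mul_comm => exact act_altProd _
  | br_skew => exact act_swap_altBr.trans (neg_one_smul 𝕜 _).symm
  | mul_assoc =>
    exact (altProd_comp_altProd (n := 2) rfl 0).trans (altProd_comp_altProd (n := 2) rfl 1).symm
  | leibniz =>
    change comp 0 (altBr 𝕜) (altProd 𝕜 2) = comp 1 (altProd 𝕜 2) (altBr 𝕜) +
      (Alt 𝕜).act (Equiv.swap 0 1) (comp 1 (altProd 𝕜 2) (altBr 𝕜))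
    rw [altBr, altInr_comp_altProd, altProd_comp_altInr, act_altInr, ← map_add]
    exact congrArg (altInr 3) altPull_collapse_altBasis_leibniz
  | jacobi =>
    change comp 1 (altBr 𝕜) (altBr 𝕜) = comp 0 (altBr 𝕜) (altBr 𝕜) +
      (Alt 𝕜).act (Equiv.swap 0 1) (comp 1 (altBr 𝕜) (altBr 𝕜))
    rw [altBr, altInr_comp_altInr, altInr_comp_altInr, map_zero, add_zero]

variable (𝕜) in
/-- The morphism from `Pois` to `Alt` that preserves the product and the bracket. -/
def poisToAlt : OperadHom (Pois 𝕜).toOperad (Alt 𝕜).toOperad :=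
  presentedLift (Alt 𝕜).toOperad (poisGenToAlt 𝕜) fun _ _ _ => eval_poisGenToAlt_eq

theorem pois_modTrunc_three_iso_alt : OperadIso ((Pois 𝕜).modTrunc 3) (Alt 𝕜).toOperad :=
  UnitaryOperad.modTrunc_iso_alt pois_isConnected (poisToAlt 𝕜) rfl pois_two_eq rfl rfl

end Poisson

section Obstruction

variable {𝕜 : Type u} [CommRing 𝕜]

/-- The projection of an operad onto its quotient by an ideal. -/
def Operad.quotientHom (P : Operad 𝕜) (I : P.OpIdeal) : OperadHom P (P.quotient I) where
  toFun n := (I.carrier n).mkQ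
  map_one := rfl
  map_act _ _ := rfl
  map_comp _ _ _ _ := rfl

/-- A binary operation is a commutative unital product if it is symmetric and has a unit; by
symmetry it is enough that the unit is neutral on the left. -/
def Operad.IsCommUnital (P : Operad 𝕜) (x : P.obj 2) : Prop :=
  P.act (Equiv.swap 0 1) x = x ∧ ∃ u, P.comp (n := 0) (r := 1) rfl 0 x u = P.one

/-- Associativity of a binary operation. -/
def Operad.IsAssoc (P : Operad 𝕜) (x : P.obj 2) : Prop :=
  P.comp (n := 2) (r := 3) rfl 0 x x = P.comp (n := 2) (r := 3) rfl 1 x x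

theorem OperadHom.isCommUnital {P Q : Operad 𝕜} (f : OperadHom P Q) {x : P.obj 2}
    (hx : P.IsCommUnital x) : Q.IsCommUnital (f.toFun 2 x) :=
  let ⟨hx, u, hu⟩ := hx
  ⟨by rw [← f.map_act, hx], f.toFun 0 u, by rw [← f.map_comp, hu, f.map_one]⟩

theorem OperadHom.isAssoc {P Q : Operad 𝕜} (f : OperadHom P Q) {x : P.obj 2}
    (hx : P.IsAssoc x) : Q.IsAssoc (f.toFun 2 x) := by
  rw [Operad.IsAssoc] at hx ⊢
  rw [← f.map_comp, hx, f.map_comp]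

theorem UnitaryOperad.isCommUnital_of_modTrunc {P : UnitaryOperad 𝕜} {k : ℕ} (hk : 3 ≤ k)
    {x : P.obj 2} (hx : (P.modTrunc k).IsCommUnital (Submodule.Quotient.mk x)) :
    P.IsCommUnital x := by
  obtain ⟨hx, u, hu⟩ := hx
  obtain ⟨u, rfl⟩ := Submodule.Quotient.mk_surjective _ u
  exact ⟨P.modTrunc_mk_injective (show 2 < k by omega) hx, u,
    P.modTrunc_mk_injective (show 1 < k by omega) hu⟩

theorem UnitaryOperad.isAssoc_of_modTrunc {P : UnitaryOperad 𝕜} {k : ℕ} (hk : 4 ≤ k)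
    {x : P.obj 2} (hx : (P.modTrunc k).IsAssoc (Submodule.Quotient.mk x)) : P.IsAssoc x :=
  P.modTrunc_mk_injective (show 3 < k by omega) hx

theorem pois_isCommUnital_poisMul : (Pois 𝕜).IsCommUnital (poisMul 𝕜) :=
  ⟨act_swap_poisMul 𝕜, _, poisMul_comp_unit0 𝕜 0⟩

variable (𝕜) in
/-- The symmetrized product, or anticommutator, of `As`. -/
noncomputable def asAnti : (As 𝕜).obj 2 := asPerm 𝕜 1 + asPerm 𝕜 (Equiv.swap 0 1)

theorem as_eq_smul_asAnti_of_act_swap_eq {x : (As 𝕜).obj 2}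
    (hx : (As 𝕜).act (Equiv.swap 0 1) x = x) : ∃ a : 𝕜, x = a • asAnti 𝕜 := by
  obtain ⟨a, b, rfl⟩ := as_two_eq x
  let coeffOne : (As 𝕜).obj 2 →ₗ[𝕜] 𝕜 := asLinearLift fun σ => if σ = 1 then 1 else 0
  have swap_ne_one : Equiv.swap (0 : Fin 2) 1 ≠ 1 := by decide
  have hba : b = a := by
    have := congrArg coeffOne hx
    simpa only [coeffOne, map_add, map_smul, as_act_asPerm, asLinearLift_asPerm, one_mul,
      Equiv.swap_mul_self, if_neg swap_ne_one, if_true, smul_eq_mul, mul_zero, mul_one, zero_add,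
      add_zero] using this
  exact ⟨a, by rw [hba, asAnti, smul_add]⟩

theorem exists_two_mul_mul_eq_one_of_isCommUnital_smul_asAnti {a : 𝕜}
    (ha : (As 𝕜).IsCommUnital (a • asAnti 𝕜)) : ∃ c : 𝕜, 2 * a * c = 1 := by
  obtain ⟨-, u, hu⟩ := ha
  let c : 𝕜 := (asToCom 𝕜).toFun 0 u
  have image : a * (1 + 1) * c = 1 := by
    have := congrArg ((asToCom 𝕜).toFun 1) hu
    rwa [(asToCom 𝕜).map_comp, (asToCom 𝕜).map_one, map_smul, asAnti, map_add, asToCom_asPerm,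
      asToCom_asPerm] at this
  exact ⟨c, by linear_combination image⟩

/-- The sum of the coefficients of the words in three letters with the first variable in the
middle. It tells the two bracketings of the anticommutator apart, since a variable that is
multiplied last never stands in the middle. -/
noncomputable def middleCoeff : (As 𝕜).obj 3 →ₗ[𝕜] 𝕜 :=
  asLinearLift fun σ => if (σ 0).1 = 1 then 1 else 0

theorem middleCoeff_comp_zero (φ σ : Equiv.Perm (Fin 2)) :
    middleCoeff ((As 𝕜).comp (n := 2) rfl 0 (asPerm 𝕜 φ) (asPerm 𝕜 σ)) =
      if (φ 0).1 + (σ 0).1 = 1 then 1 else 0 := by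
  have position := permComp_inner' (n := 2) (r := 3) rfl φ σ (i := 0) (x := 0) 0 rfl
  rw [as_comp_asPerm, middleCoeff, asLinearLift_asPerm, position]

theorem middleCoeff_comp_one (φ σ : Equiv.Perm (Fin 2)) :
    middleCoeff ((As 𝕜).comp (n := 2) rfl 1 (asPerm 𝕜 φ) (asPerm 𝕜 σ)) = 0 := by
  have position := permComp_outer' (n := 2) (r := 3) rfl φ σ (i := 1) (x := 0) 0 (by decide) rfl
  rw [as_comp_asPerm, middleCoeff, asLinearLift_asPerm, position, if_neg]
  have := Fin.val_ne_of_ne (φ.injective.ne (zero_ne_one (α := Fin 2)))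
  unfold shift
  split_ifs <;> omega

theorem two_mul_mul_eq_zero_of_isAssoc_smul_asAnti {a : 𝕜}
    (ha : (As 𝕜).IsAssoc (a • asAnti 𝕜)) : 2 * a * a = 0 := by
  have coeffs := congrArg middleCoeff ha
  simp only [asAnti, map_smul, map_add, LinearMap.smul_apply, LinearMap.add_apply,
    middleCoeff_comp_zero, middleCoeff_comp_one, Equiv.Perm.one_apply, Equiv.swap_apply_left,
    Fin.val_zero, Fin.val_one, smul_eq_mul, add_zero, zero_add, mul_zero, zero_ne_one, if_true,
    if_false, OfNat.ofNat_ne_one, one_add_one_eq_two] at coeffs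
  linear_combination coeffs

theorem isUnit_two_of_as_isCommUnital {x : (As 𝕜).obj 2} (hx : (As 𝕜).IsCommUnital x) :
    IsUnit (2 : 𝕜) := by
  obtain ⟨a, rfl⟩ := as_eq_smul_asAnti_of_act_swap_eq hx.1
  obtain ⟨c, hc⟩ := exists_two_mul_mul_eq_one_of_isCommUnital_smul_asAnti hx
  exact .of_mul_eq_one (a * c) (by rw [← mul_assoc, hc])

theorem as_not_isAssoc_of_isCommUnital [Nontrivial 𝕜] {x : (As 𝕜).obj 2}
    (hx : (As 𝕜).IsCommUnital x) : ¬ (As 𝕜).IsAssoc x := by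
  obtain ⟨a, rfl⟩ := as_eq_smul_asAnti_of_act_swap_eq hx.1
  obtain ⟨c, hc⟩ := exists_two_mul_mul_eq_one_of_isCommUnital_smul_asAnti hx
  intro hassoc
  have ha := two_mul_mul_eq_zero_of_isAssoc_smul_asAnti hassoc
  exact one_ne_zero (α := 𝕜) (by linear_combination (-2 * a * c - 1) * hc + 2 * c ^ 2 * ha)

theorem isUnit_two_of_hom {k : ℕ} (hk : 3 ≤ k)
    (f : OperadHom (Pois 𝕜).toOperad ((As 𝕜).modTrunc k)) : IsUnit (2 : 𝕜) := by
  obtain ⟨x, hx⟩ := Submodule.Quotient.mk_surjective _ (f.toFun 2 (poisMul 𝕜))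
  have unital := f.isCommUnital pois_isCommUnital_poisMul
  rw [← hx] at unital
  exact isUnit_two_of_as_isCommUnital (UnitaryOperad.isCommUnital_of_modTrunc hk unital)

theorem isEmpty_hom_of_four_le [Nontrivial 𝕜] {k : ℕ} (hk : 4 ≤ k) :
    IsEmpty (OperadHom (Pois 𝕜).toOperad ((As 𝕜).modTrunc k)) := by
  refine ⟨fun f => ?_⟩
  obtain ⟨x, hx⟩ := Submodule.Quotient.mk_surjective _ (f.toFun 2 (poisMul 𝕜))
  have unital := f.isCommUnital pois_isCommUnital_poisMul
  have assoc := f.isAssoc (poisMul_assoc 𝕜)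
  rw [← hx] at unital assoc
  exact as_not_isAssoc_of_isCommUnital
    (UnitaryOperad.isCommUnital_of_modTrunc (Nat.le_of_succ_le hk) unital)
    (UnitaryOperad.isAssoc_of_modTrunc hk assoc)

theorem nonempty_hom_of_iso {k : ℕ} (h : OperadIso ((As 𝕜).modTrunc k) ((Pois 𝕜).modTrunc k)) :
    Nonempty (OperadHom (Pois 𝕜).toOperad ((As 𝕜).modTrunc k)) :=
  let ⟨f, _⟩ := h.symm
  ⟨(Operad.quotientHom ..).trans f⟩

end Obstruction

theorem subsingleton_h1_of_iso_com {𝕜 : Type u} [CommRing 𝕜] {P : Operad 𝕜}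
    (h : OperadIso P (Com 𝕜).toOperad) : Subsingleton P.H1 :=
  have := subsingleton_h1_com (𝕜 := 𝕜)
  let ⟨e⟩ := h.nonempty_h1_equiv
  e.toEquiv.subsingleton

theorem nonempty_h1_equiv_of_iso_alt {𝕜 : Type u} [CommRing 𝕜] (h2 : IsUnit (2 : 𝕜))
    {P : Operad 𝕜} (h : OperadIso P (Alt 𝕜).toOperad) : Nonempty (P.H1 ≃ₗ[𝕜] 𝕜) :=
  let ⟨e⟩ := h.nonempty_h1_equiv
  let ⟨e'⟩ := nonempty_h1_alt_equiv h2
  ⟨e.trans e'⟩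

end Operadic

theorem theorem3p8_general (𝕜 : Type u) [CommRing 𝕜] [Nontrivial 𝕜] :
    ((OperadIso ((As 𝕜).modTrunc 1) ((Pois 𝕜).modTrunc 1) ∧
        OperadIso ((Pois 𝕜).modTrunc 1) ((As 𝕜).modTrunc 2) ∧
        OperadIso ((As 𝕜).modTrunc 2) ((Pois 𝕜).modTrunc 2) ∧
        OperadIso ((Pois 𝕜).modTrunc 2) (Com 𝕜).toOperad) ∧
      Subsingleton ((As 𝕜).modTrunc 1).H1 ∧ Subsingleton ((Pois 𝕜).modTrunc 1).H1 ∧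
      Subsingleton ((As 𝕜).modTrunc 2).H1 ∧ Subsingleton ((Pois 𝕜).modTrunc 2).H1 ∧
      Subsingleton (Com 𝕜).toOperad.H1) ∧
    (IsUnit (2 : 𝕜) →
      OperadIso ((As 𝕜).modTrunc 3) ((Pois 𝕜).modTrunc 3) ∧
      Nonempty (((As 𝕜).modTrunc 3).H1 ≃ₗ[𝕜] 𝕜) ∧
      Nonempty (((Pois 𝕜).modTrunc 3).H1 ≃ₗ[𝕜] 𝕜)) ∧
    (¬ IsUnit (2 : 𝕜) → ¬ OperadIso ((As 𝕜).modTrunc 3) ((Pois 𝕜).modTrunc 3)) ∧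
    (∀ k : ℕ, 4 ≤ k → ¬ OperadIso ((As 𝕜).modTrunc k) ((Pois 𝕜).modTrunc k)) := by
  have a₁ := as_modTrunc_iso_com (𝕜 := 𝕜) one_pos one_le_two
  have a₂ := as_modTrunc_iso_com (𝕜 := 𝕜) two_pos le_rfl
  have p₁ := pois_modTrunc_iso_com (𝕜 := 𝕜) one_pos one_le_two
  have p₂ := pois_modTrunc_iso_com (𝕜 := 𝕜) two_pos le_rfl
  refine ⟨⟨⟨a₁.trans p₁.symm, p₁.trans a₂.symm, a₂.trans p₂.symm, p₂⟩,
    subsingleton_h1_of_iso_com a₁, subsingleton_h1_of_iso_com p₁, subsingleton_h1_of_iso_com a₂,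
    subsingleton_h1_of_iso_com p₂, subsingleton_h1_com⟩, fun h2 => ?_, fun h2 h => ?_,
    fun k hk h => ?_⟩
  · have a₃ := as_modTrunc_three_iso_alt h2
    have p₃ := pois_modTrunc_three_iso_alt (𝕜 := 𝕜)
    exact ⟨a₃.trans p₃.symm, nonempty_h1_equiv_of_iso_alt h2 a₃,
      nonempty_h1_equiv_of_iso_alt h2 p₃⟩
  · obtain ⟨f⟩ := nonempty_hom_of_iso h
    exact h2 (isUnit_two_of_hom le_rfl f)
  · obtain ⟨f⟩ := nonempty_hom_of_iso h
    exact (isEmpty_hom_of_four_le hk).false f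

theorem theorem3p8 (𝕜 : Type u) [Field 𝕜] :
    -- the first and second truncations are all isomorphic to `Com`, and their `H¹` vanishes
    ((OperadIso ((As 𝕜).modTrunc 1) ((Pois 𝕜).modTrunc 1) ∧
        OperadIso ((Pois 𝕜).modTrunc 1) ((As 𝕜).modTrunc 2) ∧
        OperadIso ((As 𝕜).modTrunc 2) ((Pois 𝕜).modTrunc 2) ∧
        OperadIso ((Pois 𝕜).modTrunc 2) (Com 𝕜).toOperad) ∧
      Subsingleton ((As 𝕜).modTrunc 1).H1 ∧ Subsingleton ((Pois 𝕜).modTrunc 1).H1 ∧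
      Subsingleton ((As 𝕜).modTrunc 2).H1 ∧ Subsingleton ((Pois 𝕜).modTrunc 2).H1 ∧
      Subsingleton (Com 𝕜).toOperad.H1) ∧
    -- the third truncations in characteristic different from `2`
    (ringChar 𝕜 ≠ 2 →
      OperadIso ((As 𝕜).modTrunc 3) ((Pois 𝕜).modTrunc 3) ∧
      Nonempty (((As 𝕜).modTrunc 3).H1 ≃ₗ[𝕜] 𝕜) ∧
      Nonempty (((Pois 𝕜).modTrunc 3).H1 ≃ₗ[𝕜] 𝕜)) ∧
    -- the third truncations in characteristic `2`
    (ringChar 𝕜 = 2 → ¬ OperadIso ((As 𝕜).modTrunc 3) ((Pois 𝕜).modTrunc 3)) ∧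
    -- the higher truncations
    (∀ k : ℕ, 4 ≤ k → ¬ OperadIso ((As 𝕜).modTrunc k) ((Pois 𝕜).modTrunc k)) := by
  obtain ⟨low, three, three_not_iso, high⟩ := theorem3p8_general 𝕜
  refine ⟨low, fun hchar => three (Ring.two_ne_zero hchar).isUnit, fun hchar => ?_, high⟩
  have : CharP 𝕜 2 := ringChar.of_eq hchar
  exact three_not_iso (CharTwo.two_eq_zero (R := 𝕜) ▸ not_isUnit_zero)
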